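/- Let $p$ be a prime, $q=p^a$ with $a\ge 1$, $n\ge 1$, and let $\overline{G}=\mathrm{PSp}_{2n}(\overline{\mathbb F}_p)=\mathrm{Sp}_{2n}(\overline{\mathbb F}_p)/Z(\mathrm{Sp}_{2n}(\overline{\mathbb F}_p))$, where rows and columns of symplectic matrices are indexed by $1,\dots,n,-1,\dots,-n$. Let $\sigma$ be the automorphism of $\overline{G}$ induced by $(x_{ij})\mapsto(x_{ij}^q)$, and let $G=\mathrm{PSp}_{2n}(q)$ be the image of $\mathrm{Sp}_{2n}(q)$ in $\overline{G}$. Let $\overline{T}_0\le\overline{G}$ be the image of the group of all symplectic diagonal matrices. Its Weyl group $N_{\overline G}(\overline T_0)/\overline T_0$ is identified with the group of permutations $\varphi$ of $\{\pm1,\dots,\pm n\}$ satisfying $\varphi(-x)=-\varphi(x)$ (the permutations underlying monomial symplectic matrices). Such a $\varphi$ is uniquely a product of independent signed cycles: a cycle of length $\ell$ through $x$ (the $\ell$ elements $|\varphi^j(x)|$, $0\le j<\ell$, are distinct and $\varphi^{\ell}(x)=\pm x$) is called negative if $\varphi^{\ell}(x)=-x$ and positive if $\varphi^{\ell}(x)=x$.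 We say that $\varphi$ has cycle type $(\overline{n_1})\dots(\overline{n_k})(n_{k+1})\dots(n_m)$ if its negative cycles have lengths $n_1,\dots,n_k$ and its positive cycles have lengths $n_{k+1},\dots,n_m$; here all $n_i\ge 1$ and $n_1+\dots+n_m=n$. Let $\overline{T}$ be a $\sigma$-invariant maximal torus of $\overline{G}$, let $T=\overline{T}\cap G$ be the corresponding maximal torus of $G$, and let $N=N_{\overline{G}}(\overline{T})\cap G$. Suppose that the torus has type $(\overline{n_1})\dots(\overline{n_k})(n_{k+1})\dots(n_m)$, that is, $\overline{T}=g^{-1}\overline{T}_0\,g$ for some $g\in\overline{G}$ such that $\sigma(g)g^{-1}\in N_{\overline G}(\overline T_0)$ and the image of $\sigma(g)g^{-1}$ in the Weyl group has this cycle type. Then $T$ has a complement in $N$ (that is, $N=T\rtimes H$ for some subgroup $H$) if and only if one of the following conditions holds: 1. $p=2$; 2. $m=1$; 3. $m=2$, $k=2$, $n_1$ and $n_2$ are odd, and $q\equiv 3\pmod 4$; 4. $m=2$, $k=1$, $n_1$ is odd, $n_2$ is even, and $q\equiv 3\pmod 4$; 5. $m=2$, $k=0$, $n_1$ and $n_2$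 are even, and $q\equiv 3\pmod 4$; 6. $m=2$, $k=0$, and $q\equiv 1\pmod 4$. -/

import Mathlib

namespace SympTorus

open Matrix

noncomputable section

/-- The symplectic group `Sp_{2n}(K)`. Rows and columns are indexed by `Fin n ⊕ Fin n`,
where `Sum.inl i` plays the role of the index `i` and `Sum.inr i` that of `-i`. -/
abbrev Sp (n : ℕ) (K : Type*) [Field K] : Type _ := symplecticGroup (Fin n) K

/-- The projective symplectic group `PSp_{2n}(K)`, the quotient of `Sp_{2n}(K)` by its center. -/
abbrev PSp (n : ℕ) (K : Type*) [Field K] : Type _ := Sp n K ⧸ Subgroup.center (Sp n K)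

/-- The projection `Sp_{2n}(K) → PSp_{2n}(K)`. -/
def proj (n : ℕ) (K : Type*) [Field K] : Sp n K →* PSp n K :=
  QuotientGroup.mk' (Subgroup.center (Sp n K))

/-! ### Maximal tori of the algebraic group `PSp_{2n}` over an algebraically closed field -/

section Tori

variable (n : ℕ) (K : Type*) [Field K]

/-- The Zariski topology on `Sp_{2n}(K)`: it is generated by the basic open sets `{A | f(A) ≠ 0}`,
where `f` is a polynomial in the matrix entries. -/
abbrev zariskiSp : TopologicalSpace (Sp n K) :=
  TopologicalSpace.generateFrom
    {U | ∃ f : MvPolynomial ((Fin n ⊕ Fin n) × (Fin n ⊕ Fin n)) K,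
      U = {A : Sp n K | MvPolynomial.eval (fun ij => A.1 ij.1 ij.2) f ≠ 0}}

/-- The Zariski topology on `PSp_{2n}(K)`: the quotient topology. -/
abbrev zariskiPSp : TopologicalSpace (PSp n K) :=
  TopologicalSpace.coinduced (proj n K) (zariskiSp n K)

/-- A torus (`K` algebraically closed): a Zariski-closed, Zariski-connected, commutative subgroup
consisting of semisimple elements. -/
structure IsTorus (S : Subgroup (PSp n K)) : Prop where
  closed : @IsClosed _ (zariskiPSp n K) (S : Set (PSp n K))
  connected : @IsConnected _ (zariskiPSp n K) (S : Set (PSp n K))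
  comm : ∀ x ∈ S, ∀ y ∈ S, x * y = y * x
  semisimple : ∀ A : Sp n K, proj n K A ∈ S → Module.End.IsSemisimple (Matrix.toLin' A.1)

/-- A maximal torus. -/
def IsMaximalTorus (S : Subgroup (PSp n K)) : Prop := Maximal (IsTorus n K) S

/-- The homomorphism `D ↦ bd(D, D⁻¹)`, `D` an invertible diagonal `n × n` matrix. -/
def diagHom : (Fin n → Kˣ) →* Sp n K where
  toFun d := ⟨fromBlocks (diagonal fun i => (d i : K)) 0 0 (diagonal fun i => ((d i)⁻¹ : Kˣ)), by
    rw [SymplecticGroup.fromBlocks_mem_iff]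
    simp⟩
  map_one' := by
    apply Subtype.ext
    simp
  map_mul' d e := by
    apply Subtype.ext
    simp [mul_comm]

/-- The standard maximal torus of `PSp_{2n}(K)`: the image of the group of all `bd(D, D⁻¹)`. -/
def stdTorus : Subgroup (PSp n K) := (diagHom n K).range.map (proj n K)

end Tori

/-! ### The Steinberg endomorphism and the finite groups -/

section Frobenius

/-- A field automorphism `f` acts on `Sp_{2n}(K)` entrywise. -/
def spCongr (n : ℕ) {K : Type*} [Field K] (f : K ≃+* K) : Sp n K ≃* Sp n K where
  toFun A := ⟨A.1.map f, SymplecticGroup.map_mem A.2 f⟩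
  invFun A := ⟨A.1.map f.symm, SymplecticGroup.map_mem A.2 f.symm⟩
  left_inv A := by
    apply Subtype.ext
    ext i j
    simp
  right_inv A := by
    apply Subtype.ext
    ext i j
    simp
  map_mul' A B := by
    apply Subtype.ext
    simp [Matrix.map_mul]

/-- The automorphism of `PSp_{2n}(K)` induced by `spCongr n f`. -/
def pspCongr (n : ℕ) {K : Type*} [Field K] (f : K ≃+* K) : PSp n K ≃* PSp n K :=
  QuotientGroup.congr (Subgroup.center (Sp n K)) (Subgroup.center (Sp n K)) (spCongr n f)
    (Subgroup.characteristic_iff_map_eq.mp inferInstance (spCongr n f))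

variable (n p a : ℕ) (K : Type*) [Field K] [ExpChar K p] [PerfectRing K p]

/-- `σ : (x_{ij}) ↦ (x_{ij}^q)` on `Sp_{2n}(K)`, where `q = p ^ a`. -/
def sigmaSp : Sp n K ≃* Sp n K := spCongr n (iterateFrobeniusEquiv K p a)

/-- The map `σ` on `PSp_{2n}(K)` induced by `(x_{ij}) ↦ (x_{ij}^q)`, where `q = p ^ a`. -/
def sigma : PSp n K ≃* PSp n K := pspCongr n (iterateFrobeniusEquiv K p a)

/-- The finite group `PSp_{2n}(q)`, `q = p ^ a`, as a subgroup of `PSp_{2n}(K)`: the image of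
`Sp_{2n}(q) = {A ∈ Sp_{2n}(K) | σ(A) = A}`. -/
def finitePSp : Subgroup (PSp n K) :=
  ((sigmaSp n p a K).toMonoidHom.eqLocus (MonoidHom.id (Sp n K))).map (proj n K)

end Frobenius

/-! ### Signed permutations and types of tori -/

/-- `φ` belongs to the group `Sl_n` of permutations of `{1, …, n, -1, …, -n}` that satisfy
`φ(-x) = -φ(x)`. -/
def IsSignedPerm {n : ℕ} (φ : Equiv.Perm (Fin n ⊕ Fin n)) : Prop :=
  ∀ x, φ x.swap = (φ x).swap

/-- The absolute value `{1, …, n, -1, …, -n} → {1, …, n}`. -/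
def absIdx {n : ℕ} : Fin n ⊕ Fin n → Fin n := Sum.elim id id

/-- The signed permutation `φ` has cycle type `(l̄ 1) … (l̄ k) (l (k+1)) … (l m)`: it is a product of
`m` independent cycles, of lengths `l 1, …, l m`, the first `k` negative and the others positive.
Here `r i` is a starting point of the cycle number `i + 1`, which runs through the absolute values
of `r, φ r, φ² r, …`; it is negative if `φ ^ length` maps `r` to `-r`, and positive if it fixes
`r`. -/
def HasCycleType {n : ℕ} (φ : Equiv.Perm (Fin n ⊕ Fin n)) (m k : ℕ) (l : ℕ → ℕ) : Prop :=
  ∃ r : Fin m → Fin n,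
    Function.Bijective
      (fun x : (i : Fin m) × Fin (l (i + 1)) => absIdx ((φ ^ (x.2 : ℕ)) (Sum.inl (r x.1)))) ∧
    ∀ i : Fin m, (φ ^ l (i + 1)) (Sum.inl (r i)) =
      if (i : ℕ) + 1 ≤ k then Sum.inr (r i) else Sum.inl (r i)

/-- `x ∈ PSp_{2n}(K)` lies in the normalizer of the standard torus and maps to `φ` in the Weyl
group: it is represented by a monomial matrix whose underlying permutation is `φ`. -/
def MapsToWeyl {n : ℕ} {K : Type*} [Field K] (x : PSp n K) (φ : Equiv.Perm (Fin n ⊕ Fin n)) :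
    Prop :=
  ∃ A : Sp n K, proj n K A = x ∧ ∀ i j, A.1 i j ≠ 0 ↔ i = φ j

/-- The subgroup `S` has type `(l̄ 1) … (l̄ k) (l (k+1)) … (l m)`: it is `g⁻¹ T₀ g`, where `T₀` is the
standard torus, for some `g` such that `σ(g) g⁻¹` lies in the normalizer of `T₀` and maps to an
element of this cycle type in the Weyl group. -/
def HasType (n p a : ℕ) (K : Type*) [Field K] [ExpChar K p] [PerfectRing K p]
    (S : Subgroup (PSp n K)) (m k : ℕ) (l : ℕ → ℕ) : Prop :=
  ∃ (g : PSp n K) (φ : Equiv.Perm (Fin n ⊕ Fin n)),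
    S = (stdTorus n K).map (MulAut.conj g⁻¹).toMonoidHom ∧
    IsSignedPerm φ ∧ MapsToWeyl (sigma n p a K g * g⁻¹) φ ∧ HasCycleType φ m k l

/-- `T` has a complement in `N`: `N = T ⋊ H` for some subgroup `H`. -/
def HasComplementIn {G : Type*} [Group G] (T N : Subgroup G) : Prop :=
  T ≤ N ∧ (T.subgroupOf N).Normal ∧ ∃ H : Subgroup N, (T.subgroupOf N).IsComplement' H

end

end SympTorus

/-!
Conjugation by `g` turns the torus into the group of diagonal matrices, its normalizer into the
group of monomial symplectic matrices, and the Frobenius map into its twist by a monomial matrix `w`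
whose signed permutation has the given cycle type (`hasComplementIn_conj_iff`). The symplectic
monomial group is the wreath product of the monomial subgroup of `SL₂` with a symmetric group, and
by Lang's theorem for the diagonal torus, which is solved explicitly along each cycle
(`lang_cycle`), `w` may be replaced by any convenient matrix with the same signed permutation up to
conjugation (`splits_iff_stdMono`). It remains to decide whether the group of monomial matrices
fixed by the twisted Frobenius map, modulo `±1`, splits over its diagonal part (`Splits`).

In characteristic two the permutation matrices form a complement (`splits_of_neg_one_eq_one`). For a
single cycle the monomial matrices with entries `0, ±1` that commute with `w` do
(`splits_of_subsingleton`).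

Let now `q` be odd and let there be at least two cycles. The negation of one cycle belongs to the
centralizer of the signed permutation. A matrix that represents it squares to `-1` on this cycle, so
in a complement its square has to be `-1` everywhere, and it acts on each other cycle as a diagonal
matrix `I` of order four. Such an `I` is fixed by the twisted Frobenius map if and only if
`κ n ≡ ν` modulo `2`, where `n` is the length of that cycle, `ν = 1` for negative and `ν = 0` for
positive cycles, and `κ = (q - 1) / 2` (`parity_of_splits`). The negations of two cycles anticommute
on these cycles and commute on a third one, so there is no complement for three or more cycles
(`not_splits_of_three`).

For two cycles the parity condition suffices (`splits_of_fin_two`). On each cycle there are the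
matrix `w`, the matrix `J` for the negation, and `I`, with `J ^ 2 = I ^ 2 = -1`, `J I = - I J`,
`w I = (-1) ^ κ I w`, `w J = J w`. The generators `(J, I)`, `(I, J)`, `(w, I ^ κ)`, `(I ^ κ, w)`
commute modulo `±1`, since the signs on the two cycles agree. The free sign of `w` on each cycle is
chosen so that `(w, I ^ κ) ^ n = ± (J, I) ^ ν`, and then these elements generate a complement modulo
`±1`, to which the interchange of the cycles has to be adjoined if they are of the same type.
-/

namespace SympTorus

/-! ### The monomial subgroup of `SL₂` -/

/-- The monomial elements of `SL₂(K)`: `diag a` is the matrix with diagonal entries `a, a⁻¹`, and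
`anti a` maps `e₁` to `a e₂` and `e₂` to `-a⁻¹ e₁`. -/
inductive MonoSL2 (K : Type*) [Field K]
  | diag (a : Kˣ)
  | anti (a : Kˣ)

namespace MonoSL2

variable {K : Type*} [Field K]

/-- Matrix multiplication of monomial matrices. -/
def mul : MonoSL2 K → MonoSL2 K → MonoSL2 K
  | diag a, diag b => diag (a * b)
  | diag a, anti b => anti (a⁻¹ * b)
  | anti a, diag b => anti (a * b)
  | anti a, anti b => diag (-a⁻¹ * b)

/-- Inversion of monomial matrices. -/
def inv : MonoSL2 K → MonoSL2 K
  | diag a => diag a⁻¹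
  | anti a => anti (-a)

instance : Mul (MonoSL2 K) := ⟨mul⟩
instance : One (MonoSL2 K) := ⟨diag 1⟩
instance : Inv (MonoSL2 K) := ⟨inv⟩

theorem one_def : (1 : MonoSL2 K) = diag 1 := rfl
@[simp] theorem diag_mul_diag (a b : Kˣ) : diag a * diag b = diag (a * b) := rfl
@[simp] theorem diag_mul_anti (a b : Kˣ) : diag a * anti b = anti (a⁻¹ * b) := rfl
@[simp] theorem anti_mul_diag (a b : Kˣ) : anti a * diag b = anti (a * b) := rfl
@[simp] theorem anti_mul_anti (a b : Kˣ) : anti a * anti b = diag (-a⁻¹ * b) := rfl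
@[simp] theorem inv_diag (a : Kˣ) : (diag a)⁻¹ = diag a⁻¹ := rfl
@[simp] theorem inv_anti (a : Kˣ) : (anti a)⁻¹ = anti (-a) := rfl

instance : Group (MonoSL2 K) :=
  Group.ofLeftAxioms
    (by rintro (a | a) (b | b) (c | c) <;> simp [mul_assoc, mul_comm, mul_left_comm])
    (by rintro (a | a) <;> simp [one_def])
    (by rintro (a | a) <;> simp [one_def])

/-- The sign of the underlying signed permutation: `1` on diagonal and `-1` on antidiagonal
matrices. -/
def sgn : MonoSL2 K →* ℤˣ where
  toFun
    | diag _ => 1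
    | anti _ => -1
  map_one' := rfl
  map_mul' := by rintro (a | a) (b | b) <;> simp

@[simp] theorem sgn_diag (a : Kˣ) : sgn (diag a) = 1 := rfl
@[simp] theorem sgn_anti (a : Kˣ) : sgn (anti a) = -1 := rfl

theorem sgn_eq_one {x : MonoSL2 K} (h : sgn x = 1) : ∃ a, x = diag a := by
  rcases x with a | a
  · exact ⟨a, rfl⟩
  · exact absurd (show (-1 : ℤˣ) = 1 from h) (by decide)

theorem sgn_eq_neg_one {x : MonoSL2 K} (h : sgn x = -1) : ∃ a, x = anti a := by
  rcases x with a | a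
  · exact absurd (show (1 : ℤˣ) = -1 from h) (by decide)
  · exact ⟨a, rfl⟩

/-- A field automorphism acts on matrix entries. -/
def frob (f : K ≃+* K) : MonoSL2 K ≃* MonoSL2 K where
  toFun
    | diag a => diag (Units.map f a)
    | anti a => anti (Units.map f a)
  invFun
    | diag a => diag (Units.map f.symm a)
    | anti a => anti (Units.map f.symm a)
  left_inv := by rintro (a | a) <;> simp [Units.ext_iff]
  right_inv := by rintro (a | a) <;> simp [Units.ext_iff]
  map_mul' := by rintro (a | a) (b | b) <;> simp

@[simp] theorem frob_diag (f : K ≃+* K) (a : Kˣ) : frob f (diag a) = diag (Units.map f a) := rfl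
@[simp] theorem frob_anti (f : K ≃+* K) (a : Kˣ) : frob f (anti a) = anti (Units.map f a) := rfl

@[simp] theorem sgn_frob (f : K ≃+* K) (x : MonoSL2 K) : sgn (frob f x) = sgn x := by
  rcases x with a | a <;> rfl

/-- The matrix `-1`. -/
def negOne : MonoSL2 K := diag (-1)

theorem negOne_mul (x : MonoSL2 K) : negOne * x = x * negOne := by
  rcases x with a | a <;> simp [negOne]

@[simp] theorem negOne_mul_negOne : (negOne : MonoSL2 K) * negOne = 1 := by
  simp [negOne, one_def]

theorem negOne_pow (k : ℕ) : (negOne : MonoSL2 K) ^ k = diag ((-1) ^ k) := by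
  induction k with
  | zero => rw [pow_zero, pow_zero, one_def]
  | succ k ih => rw [pow_succ, ih, negOne, diag_mul_diag, pow_succ]

@[simp] theorem frob_negOne (f : K ≃+* K) : frob f (negOne : MonoSL2 K) = negOne := by
  simp [negOne]

@[simp] theorem sgn_negOne : sgn (negOne : MonoSL2 K) = 1 := rfl

end MonoSL2

/-! ### Wreath products with a symmetric group -/

/-- The wreath product of a group `M` with the group of all permutations of `ι`. For `M` a group
of linear automorphisms of `V`, the element with permutation `π` and labels `m` maps the copy of
`v` number `i` to the copy of `m i v` number `π i`. -/
@[ext] structure Wreath (ι M : Type*) where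
  /-- the permutation of the index set -/
  perm : Equiv.Perm ι
  /-- the labels -/
  lab : ι → M

namespace Wreath

theorem ext' {ι M : Type*} {A B : Wreath ι M} (h : ∀ i, A.perm i = B.perm i) (h' : ∀ i, A.lab i = B.lab i) :
    A = B := Wreath.ext (Equiv.ext h) (funext h')

variable {ι κ M N : Type*} [Group M] [Group N]

instance : Mul (Wreath ι M) := ⟨fun A B => ⟨A.perm * B.perm, fun i => A.lab (B.perm i) * B.lab i⟩⟩
instance : One (Wreath ι M) := ⟨⟨1, fun _ => 1⟩⟩
instance : Inv (Wreath ι M) := ⟨fun A => ⟨A.perm⁻¹, fun i => (A.lab (A.perm⁻¹ i))⁻¹⟩⟩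

@[simp] theorem mul_perm (A B : Wreath ι M) : (A * B).perm = A.perm * B.perm := rfl
@[simp] theorem mul_lab (A B : Wreath ι M) (i : ι) :
    (A * B).lab i = A.lab (B.perm i) * B.lab i := rfl
@[simp] theorem one_perm : (1 : Wreath ι M).perm = 1 := rfl
@[simp] theorem one_lab (i : ι) : (1 : Wreath ι M).lab i = 1 := rfl
@[simp] theorem inv_perm (A : Wreath ι M) : A⁻¹.perm = A.perm⁻¹ := rfl
@[simp] theorem inv_lab (A : Wreath ι M) (i : ι) : A⁻¹.lab i = (A.lab (A.perm⁻¹ i))⁻¹ := rfl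

instance : Group (Wreath ι M) :=
  Group.ofLeftAxioms
    (fun A B C => ext' (fun i => by simp) (fun i => by simp [mul_assoc]))
    (fun A => ext' (fun i => by simp) (fun i => by simp))
    (fun A => ext' (fun i => by simp) (fun i => by simp))

@[simp] theorem pow_perm (A : Wreath ι M) (k : ℕ) : (A ^ k).perm = A.perm ^ k := by
  induction k with
  | zero => rfl
  | succ k ih => rw [pow_succ, pow_succ, mul_perm, ih]

/-- A homomorphism of label groups extends to wreath products. -/
def map (f : M →* N) : Wreath ι M →* Wreath ι N where
  toFun A := ⟨A.perm, fun i => f (A.lab i)⟩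
  map_one' := ext' (fun i => by simp) (fun i => by simp)
  map_mul' A B := ext' (fun i => by simp) (fun i => by simp)

@[simp] theorem map_lab (f : M →* N) (A : Wreath ι M) (i : ι) :
    (map f A).lab i = f (A.lab i) := rfl

/-- The elements with trivial permutation. -/
def base : (ι → M) →* Wreath ι M where
  toFun m := ⟨1, m⟩
  map_one' := rfl
  map_mul' _ _ := ext' (fun i => by simp) (fun i => by simp)

@[simp] theorem base_perm (m : ι → M) : (base m).perm = 1 := rfl
@[simp] theorem base_lab (m : ι → M) : (base m).lab = m := rfl

/-- Change of the index set. -/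
def reindex (e : ι ≃ κ) : Wreath ι M ≃* Wreath κ M where
  toFun A := ⟨e.permCongr A.perm, fun i => A.lab (e.symm i)⟩
  invFun A := ⟨e.symm.permCongr A.perm, fun i => A.lab (e i)⟩
  left_inv A := ext' (fun i => by simp) (fun i => by simp)
  right_inv A := ext' (fun i => by simp) (fun i => by simp)
  map_mul' A B := ext' (fun i => by simp) (fun i => by simp)

@[simp] theorem reindex_perm (e : ι ≃ κ) (A : Wreath ι M) (i : κ) :
    (reindex e A).perm i = e (A.perm (e.symm i)) := rfl
@[simp] theorem reindex_lab (e : ι ≃ κ) (A : Wreath ι M) (i : κ) :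
    (reindex e A).lab i = A.lab (e.symm i) := rfl

/-- Families of elements of wreath products over `β j` act on the disjoint union of the `β j`. -/
def glue {α : Type*} {β : α → Type*} : (∀ j, Wreath (β j) M) →* Wreath (Σ j, β j) M where
  toFun A := ⟨Equiv.Perm.sigmaCongrRight fun j => (A j).perm, fun x => (A x.1).lab x.2⟩
  map_one' := ext' (fun i => by simp) (fun i => by simp)
  map_mul' A B := ext' (fun i => by simp) (fun i => rfl)

section glue
variable {α : Type*} {β : α → Type*}

@[simp] theorem glue_perm (A : ∀ j, Wreath (β j) M) (x : Σ j, β j) :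
    (glue A).perm x = ⟨x.1, (A x.1).perm x.2⟩ := rfl
@[simp] theorem glue_lab (A : ∀ j, Wreath (β j) M) (x : Σ j, β j) :
    (glue A).lab x = (A x.1).lab x.2 := rfl

theorem glue_pow_perm (A : ∀ j, Wreath (β j) M) (k : ℕ) (x : Σ j, β j) :
    ((glue A) ^ k).perm x = ⟨x.1, ((A x.1).perm ^ k) x.2⟩ := by
  rw [← map_pow, glue_perm, Pi.pow_apply, pow_perm]

theorem glue_pow_lab (A : ∀ j, Wreath (β j) M) (k : ℕ) (x : Σ j, β j) :
    ((glue A) ^ k).lab x = ((A x.1) ^ k).lab x.2 := by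
  rw [← map_pow, glue_lab, Pi.pow_apply]

theorem glue_injective : Function.Injective (glue : (∀ j, Wreath (β j) M) →* _) := by
  intro A B h
  funext j
  refine ext' (fun i => ?_) (fun i => ?_)
  · have := congrArg (fun C : Wreath (Σ j, β j) M => C.perm ⟨j, i⟩) h
    simpa using this
  · exact congrArg (fun C : Wreath (Σ j, β j) M => C.lab ⟨j, i⟩) h

theorem map_glue (f : M →* N) (A : ∀ j, Wreath (β j) M) :
    map f (glue A) = glue fun j => map f (A j) := rfl

end glue
end Wreath

/-! ### The monomial symplectic group -/

open MonoSL2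

variable {ι κ K : Type*} [Field K]

/-- The group of monomial symplectic matrices: the wreath product of the monomial subgroup of
`SL₂` with the symmetric group. -/
abbrev Mono (ι K : Type*) [Field K] := Wreath ι (MonoSL2 K)

/-- The signed permutation that underlies a monomial symplectic matrix. Its kernel is the diagonal
torus. -/
def signedPerm : Mono ι K →* Wreath ι ℤˣ := Wreath.map sgn

/-- The action of a field automorphism on monomial symplectic matrices. -/
def frobMono (f : K ≃+* K) : Mono ι K →* Mono ι K := Wreath.map (frob f).toMonoidHom

@[simp] theorem signedPerm_perm (A : Mono ι K) : (signedPerm A).perm = A.perm := rfl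
@[simp] theorem signedPerm_lab (A : Mono ι K) (i : ι) : (signedPerm A).lab i = sgn (A.lab i) := rfl
@[simp] theorem frobMono_perm (f : K ≃+* K) (A : Mono ι K) : (frobMono f A).perm = A.perm := rfl
@[simp] theorem frobMono_lab (f : K ≃+* K) (A : Mono ι K) (i : ι) :
    (frobMono f A).lab i = frob f (A.lab i) := rfl

@[simp] theorem signedPerm_frobMono (f : K ≃+* K) (A : Mono ι K) :
    signedPerm (frobMono f A) = signedPerm A :=
  Wreath.ext' (fun _ => rfl) (fun i => by simp)

/-- The matrix `-1` as a monomial symplectic matrix. -/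
def negMono : Mono ι K := Wreath.base fun _ => negOne

@[simp] theorem negMono_perm : (negMono : Mono ι K).perm = 1 := rfl
@[simp] theorem negMono_lab (i : ι) : (negMono : Mono ι K).lab i = negOne := rfl

theorem negMono_mul (A : Mono ι K) : negMono * A = A * negMono :=
  Wreath.ext' (fun i => by simp) (fun i => by simp [negOne_mul])

@[simp] theorem negMono_mul_negMono : (negMono : Mono ι K) * negMono = 1 :=
  Wreath.ext' (fun i => by simp) (fun i => by simp)

@[simp] theorem frobMono_negMono (f : K ≃+* K) : frobMono f (negMono : Mono ι K) = negMono :=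
  Wreath.ext' (fun i => by simp) (fun i => by simp)

@[simp] theorem signedPerm_negMono : signedPerm (negMono : Mono ι K) = 1 :=
  Wreath.ext' (fun i => by simp) (fun i => by simp)

/-! ### The splitting problem for monomial matrices -/

/-- The group of all monomial matrices fixed by the Frobenius map twisted by `w`, modulo `±1`,
splits over its diagonal part. -/
def Splits (f : K ≃+* K) (w : Mono ι K) : Prop :=
  ∃ H : Subgroup (Mono ι K), (∀ h ∈ H, frobMono f h * w = w * h) ∧
    (∀ h ∈ H, signedPerm h = 1 → h = 1 ∨ h = negMono) ∧ negMono ∈ H ∧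
    ∀ y, frobMono f y * w = w * y → ∃ h ∈ H, signedPerm h = signedPerm y

theorem Splits.twist {f : K ≃+* K} {w w' t : Mono ι K} (h : Splits f w)
    (ht : frobMono f t * w = w' * t) : Splits f w' := by
  obtain ⟨H, h1, h2, h3, h4⟩ := h
  have hw : w' = frobMono f t * w * t⁻¹ := by rw [ht]; group
  have hneg : ∀ s : Mono ι K, s * negMono * s⁻¹ = negMono := fun s => by
    rw [← negMono_mul]; group
  refine ⟨H.map (MulAut.conj t).toMonoidHom, ?_, ?_, ⟨negMono, h3, hneg t⟩, ?_⟩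
  · rintro _ ⟨h, hh, rfl⟩
    have := h1 h hh
    simp only [MulEquiv.toMonoidHom_eq_coe, MonoidHom.coe_coe, MulAut.conj_apply, map_mul, map_inv]
    calc _ = frobMono f t * (frobMono f h * w) * t⁻¹ := by rw [hw]; group
      _ = _ := by rw [this, hw]; group
  · rintro _ ⟨h, hh, rfl⟩ hs
    simp only [MulEquiv.toMonoidHom_eq_coe, MonoidHom.coe_coe, MulAut.conj_apply, map_mul,
      map_inv, conj_eq_one_iff] at hs ⊢
    rcases h2 h hh hs with rfl | rfl
    · simp
    · exact Or.inr (hneg t)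
  · intro y hy
    obtain ⟨h, hh, hs⟩ := h4 (t⁻¹ * y * t) (by
      simp only [map_mul, map_inv]
      calc _ = (frobMono f t)⁻¹ * (frobMono f y * w') * t := by rw [hw]; group
        _ = _ := by rw [hy, hw]; group)
    refine ⟨t * h * t⁻¹, ⟨h, hh, rfl⟩, ?_⟩
    rw [map_mul, map_mul, hs]
    simp only [map_mul, map_inv]
    group

theorem splits_iff_of_twist {f : K ≃+* K} {w w' t : Mono ι K}
    (ht : frobMono f t * w = w' * t) : Splits f w ↔ Splits f w' := by
  refine ⟨fun h => h.twist ht, fun h => h.twist (t := t⁻¹) ?_⟩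
  rw [map_inv, inv_mul_eq_iff_eq_mul, ← mul_assoc, ht]
  group

theorem Splits.reindex {f : K ≃+* K} {w : Mono ι K} (h : Splits f w) (e : ι ≃ κ) :
    Splits f (Wreath.reindex e w) := by
  obtain ⟨H, h1, h2, h3, h4⟩ := h
  have hF : ∀ y : Mono ι K, frobMono f (Wreath.reindex e y) = Wreath.reindex e (frobMono f y) :=
    fun _ => rfl
  have hS : ∀ y : Mono ι K,
      signedPerm (Wreath.reindex e y) = Wreath.reindex e (signedPerm y) := fun _ => rfl
  have hz : Wreath.reindex e (negMono : Mono ι K) = negMono :=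
    Wreath.ext' (fun i => by simp) (fun i => by simp)
  refine ⟨H.map (Wreath.reindex e).toMonoidHom, ?_, ?_, ⟨negMono, h3, by simpa using hz⟩, ?_⟩
  · rintro _ ⟨h, hh, rfl⟩
    have := congrArg (Wreath.reindex e) (h1 h hh)
    simpa [hF] using this
  · rintro _ ⟨h, hh, rfl⟩ hs
    simp only [MulEquiv.toMonoidHom_eq_coe, MonoidHom.coe_coe, hS,
      EmbeddingLike.map_eq_one_iff] at hs ⊢
    rcases h2 h hh hs with rfl | rfl
    · simp
    · exact Or.inr hz
  · intro y hy
    obtain ⟨y, rfl⟩ := (Wreath.reindex e).surjective y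
    rw [hF, ← map_mul, ← map_mul] at hy
    obtain ⟨h, hh, hs⟩ := h4 y ((Wreath.reindex e).injective hy)
    exact ⟨_, ⟨h, hh, rfl⟩, by simp [hS, hs]⟩

theorem splits_reindex_iff {f : K ≃+* K} {w : Mono ι K} (e : ι ≃ κ) :
    Splits f (Wreath.reindex e w) ↔ Splits f w := by
  refine ⟨fun h => ?_, fun h => h.reindex e⟩
  have := h.reindex e.symm
  rwa [show Wreath.reindex e.symm (Wreath.reindex e w) = w from
    (Wreath.reindex e).symm_apply_apply w] at this

end SympTorus

namespace SympTorus
open MonoSL2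

/-! ### Cycles -/

/-- The cyclic shift of `Fin n` with the label `s` at the place where the cycle closes up. -/
def cyc {M : Type*} [Group M] (n : ℕ) (s : M) : Wreath (Fin n) M :=
  ⟨finRotate n, fun i => if (i : ℕ) + 1 = n then s else 1⟩

section cyc

variable {M N : Type*} [Group M] [Group N] {n : ℕ}

@[simp] theorem cyc_perm (s : M) : (cyc n s).perm = finRotate n := rfl
@[simp] theorem cyc_lab (s : M) (i : Fin n) :
    (cyc n s).lab i = if (i : ℕ) + 1 = n then s else 1 := rfl

theorem finRotate_val (i : Fin n) :
    ((finRotate n i : Fin n) : ℕ) = if (i : ℕ) + 1 = n then 0 else (i : ℕ) + 1 := by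
  cases n with
  | zero => exact i.elim0
  | succ n => rw [coe_finRotate]; simp [Fin.ext_iff]

theorem map_cyc (f : M →* N) (s : M) : Wreath.map f (cyc n s) = cyc n (f s) :=
  Wreath.ext' (fun _ => rfl) (fun i => by
    simp only [Wreath.map_lab, cyc_lab]; split_ifs <;> simp)

theorem finRotate_pow_val (k : ℕ) (i : Fin n) (h : (i : ℕ) + k < n) :
    (((finRotate n ^ k) i : Fin n) : ℕ) = i + k := by
  induction k with
  | zero => rfl
  | succ k ih =>
    rw [pow_succ', Equiv.Perm.mul_apply, finRotate_val, ih (by omega), if_neg (by omega)]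
    omega

theorem cyc_pow_lab (s : M) {k : ℕ} (hk : k ≤ n) (i : Fin n) :
    ((cyc n s) ^ k).lab i = if n ≤ i + k then s else 1 := by
  induction k generalizing i with
  | zero => simp
  | succ k ih =>
    rw [pow_succ, Wreath.mul_lab, cyc_perm, ih (by omega), finRotate_val, cyc_lab]
    have := i.2
    split_ifs <;> first | omega | simp

theorem finRotate_pow_self (n : ℕ) : finRotate n ^ n = 1 := by
  ext i
  have h1 : (finRotate n ^ n) i
      = (finRotate n ^ (i : ℕ)) (finRotate n ((finRotate n ^ (n - i - 1)) i)) := by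
    rw [← Equiv.Perm.mul_apply, ← Equiv.Perm.mul_apply, ← pow_succ, ← pow_add]
    congr 2; omega
  have h2 : ((finRotate n ((finRotate n ^ (n - i - 1)) i) : Fin n) : ℕ) = 0 := by
    rw [finRotate_val, finRotate_pow_val _ _ (by omega), if_pos (by omega)]
  rw [h1, finRotate_pow_val _ _ (by omega), h2]
  simp

theorem cyc_pow_self (s : M) : (cyc n s) ^ n = Wreath.base fun _ => s := by
  refine Wreath.ext' (fun i => ?_) (fun i => ?_)
  · simp [finRotate_pow_self]
  · rw [cyc_pow_lab s le_rfl, if_pos (by omega), Wreath.base_lab]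

theorem finRotate_pow_zero (i : Fin n) : (finRotate n ^ (i : ℕ)) ⟨0, i.pos⟩ = i :=
  Fin.ext (by rw [finRotate_pow_val _ _ (by simp)]; simp)

theorem dvd_of_finRotate_zpow {b : ℤ} {i : Fin n} (h : (finRotate n ^ b) i = i) :
    (n : ℤ) ∣ b := by
  have hn := i.pos
  have hn' : (n : ℤ) ≠ 0 := by omega
  replace h : (finRotate n ^ b) ⟨0, hn⟩ = ⟨0, hn⟩ := by
    rw [← finRotate_pow_zero i, ← Equiv.Perm.mul_apply, ← zpow_natCast,
      (Commute.refl (finRotate n)).zpow_zpow b, Equiv.Perm.mul_apply] at h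
    exact (finRotate n ^ ((i : ℕ) : ℤ)).injective h
  have h1 : finRotate n ^ b = finRotate n ^ (b % n).toNat := by
    rw [← zpow_natCast, Int.toNat_of_nonneg (Int.emod_nonneg _ hn')]
    conv_lhs => rw [← Int.emod_add_mul_ediv b n]
    rw [zpow_add, zpow_mul, zpow_natCast, finRotate_pow_self, one_zpow, mul_one]
  have h2 := Int.emod_lt_of_pos b (by omega : (0 : ℤ) < n)
  have h3 := Int.emod_nonneg b hn'
  rw [h1, Fin.ext_iff, finRotate_pow_val _ _ (by simp; omega)] at h
  simp only at h
  exact Int.dvd_of_emod_eq_zero (by omega)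

end cyc

/-! ### The Lang theorem for a cycle -/

variable {K : Type*} [Field K]

/-- A solution of the equation that remains after one passage through a cycle. -/
theorem exists_diag_fixed [IsAlgClosed K] {Q : ℕ} (hQ : 2 ≤ Q) {C D : MonoSL2 K}
    (h : sgn C = sgn D) : ∃ b : Kˣ, C * diag b * D⁻¹ = diag (b ^ Q) := by
  have key : ∀ (r : ℕ) (_ : 0 < r) (e : Kˣ), ∃ b : Kˣ, b ^ r = e := fun r hr e => by
    obtain ⟨b, hb⟩ := IsAlgClosed.exists_pow_nat_eq (e : K) hr
    have hb0 : b ≠ 0 := by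
      rintro rfl
      exact e.ne_zero (by rw [← hb, zero_pow hr.ne'])
    exact ⟨Units.mk0 b hb0, Units.ext (by simpa using hb)⟩
  -- `anti` inverts diagonal labels, so the equation reads `b ^ (Q - 1) = e` or `b ^ (Q + 1) = e`.
  rcases C with c | c <;> rcases D with d | d
  · obtain ⟨b, hb⟩ := key (Q - 1) (by omega) (c * d⁻¹)
    refine ⟨b, ?_⟩
    rw [show b ^ Q = b ^ (Q - 1) * b by rw [← pow_succ]; congr 1; omega, hb]
    simp [mul_right_comm]
  · exact absurd (show (1 : ℤˣ) = -1 from h) (by decide)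
  · exact absurd (show (-1 : ℤˣ) = 1 from h) (by decide)
  · obtain ⟨b, hb⟩ := key (Q + 1) (by omega) (c⁻¹ * d)
    refine ⟨b, ?_⟩
    have : b ^ Q = c⁻¹ * d * b⁻¹ := by rw [← hb, pow_succ, mul_inv_cancel_right]
    rw [this]
    simp [mul_comm, ← mul_assoc]

/-- Lang's theorem for a cycle: two sequences of labels with the same product of signs are
conjugate under the twisted action. -/
theorem lang_cycle [IsAlgClosed K] (f : K ≃+* K) {q : ℕ} (hq : 2 ≤ q) (hf : ∀ x, f x = x ^ q)
    {n : ℕ} (hn : 0 < n) (g g₀ : ℕ → MonoSL2 K)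
    (hs : ∏ k ∈ Finset.range n, sgn (g k) = ∏ k ∈ Finset.range n, sgn (g₀ k)) :
    ∃ t : ℕ → MonoSL2 K, (∀ k, frob f (t (k + 1)) * g k = g₀ k * t k) ∧ t n = t 0 := by
  let T : MonoSL2 K → ℕ → MonoSL2 K := fun t₀ k =>
    Nat.rec t₀ (fun k t => (frob f).symm (g₀ k * t * (g k)⁻¹)) k
  have hT : ∀ t₀ k, T t₀ (k + 1) = (frob f).symm (g₀ k * T t₀ k * (g k)⁻¹) := fun _ _ => rfl
  have hsymm : ∀ x, sgn ((frob f).symm x) = sgn x := fun x => by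
    conv_rhs => rw [← (frob f).apply_symm_apply x, sgn_frob]
  have key : ∀ k, ∃ C D : MonoSL2 K, sgn C = ∏ k ∈ Finset.range k, sgn (g₀ k) ∧
      sgn D = ∏ k ∈ Finset.range k, sgn (g k) ∧
      ∀ b : Kˣ, T (diag (b ^ q ^ k)) k = C * diag b * D⁻¹ := by
    intro k
    induction k with
    | zero => exact ⟨1, 1, by simp, by simp, fun b => by simp [T]⟩
    | succ k ih =>
      obtain ⟨C, D, hC, hD, h⟩ := ih
      refine ⟨(frob f).symm (g₀ k * C), (frob f).symm (g k * D), ?_, ?_, fun b => ?_⟩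
      · rw [hsymm, Finset.prod_range_succ, map_mul, hC, mul_comm]
      · rw [hsymm, Finset.prod_range_succ, map_mul, hD, mul_comm]
      · rw [hT, show b ^ q ^ (k + 1) = (b ^ q) ^ q ^ k by rw [← pow_mul, pow_succ, mul_comm], h]
        have hb : (frob f).symm (diag (b ^ q)) = diag b := by
          rw [MulEquiv.symm_apply_eq, frob_diag]
          congr 1
          exact Units.ext (by simp [hf])
        rw [← hb, ← map_inv, ← map_mul, ← map_mul]
        congr 1
        group
  obtain ⟨C, D, hC, hD, h⟩ := key n
  obtain ⟨b, hb⟩ := exists_diag_fixed (Q := q ^ n) (C := C) (D := D)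
    (hq.trans (Nat.le_self_pow hn.ne' q)) (by rw [hC, hD, hs])
  refine ⟨T (diag (b ^ q ^ n)), fun k => ?_, ?_⟩
  · rw [hT, MulEquiv.apply_symm_apply]
    group
  · rw [h, hb]
    rfl

/-! ### The standard representative of a type -/

/-- The label `± 1` (for `ν = 0`) or `± anti 1` (for `ν = 1`), with sign `(-1) ^ δ`. -/
def closingLabel (K : Type*) [Field K] (δ ν : ℕ) : MonoSL2 K := negOne ^ δ * anti 1 ^ ν

@[simp] theorem sgn_closingLabel (δ ν : ℕ) : sgn (closingLabel K δ ν) = (-1) ^ ν := by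
  simp [closingLabel]

@[simp] theorem frob_closingLabel (f : K ≃+* K) (δ ν : ℕ) :
    frob f (closingLabel K δ ν) = closingLabel K δ ν := by
  simp only [closingLabel, map_mul, map_pow, frob_negOne, frob_anti]
  congr
  simp

/-- The standard monomial matrix of given type: cycle number `j` has length `L j`; it is positive
for `ν j = 0` and negative for `ν j = 1`. The number `δ j` adjusts the sign of the matrix
on this cycle. -/
def stdMono (K : Type*) [Field K] {α : Type*} (L ν δ : α → ℕ) : Mono (Σ j, Fin (L j)) K :=
  Wreath.glue fun j => cyc (L j) (closingLabel K (δ j) (ν j))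

/-- Lang's theorem: a monomial matrix that permutes the coordinates as the standard one of some
type, with the same sign on each cycle, is equivalent to the standard one. -/
theorem splits_iff_stdMono [IsAlgClosed K] (f : K ≃+* K) {q : ℕ} (hq : 2 ≤ q)
    (hf : ∀ x, f x = x ^ q) {α : Type*} (L ν δ : α → ℕ) (hL : ∀ j, 0 < L j)
    (w : Mono (Σ j, Fin (L j)) K)
    (hw : ∀ j i, w.perm ⟨j, i⟩ = ⟨j, finRotate _ i⟩)
    (hs : ∀ j, ∏ i : Fin (L j), sgn (w.lab ⟨j, i⟩) = (-1) ^ ν j) :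
    Splits f w ↔ Splits f (stdMono K L ν δ) := by
  have key : ∀ j, ∃ t : ℕ → MonoSL2 K, (∀ k (hk : k < L j), frob f (t (k + 1)) * w.lab ⟨j, k, hk⟩
      = (if k + 1 = L j then closingLabel K (δ j) (ν j) else 1) * t k) ∧ t (L j) = t 0 := by
    intro j
    obtain ⟨t, h1, h2⟩ := lang_cycle f hq hf (hL j)
      (fun k => if hk : k < L j then w.lab ⟨j, k, hk⟩ else 1)
      (fun k => if k + 1 = L j then closingLabel K (δ j) (ν j) else 1) (by
        rw [Finset.prod_range]
        simp only [Fin.is_lt, dite_true, Fin.eta, hs]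
        obtain ⟨n, hn⟩ : ∃ n, L j = n + 1 := ⟨L j - 1, by have := hL j; omega⟩
        rw [hn, Finset.prod_range_succ, Finset.prod_eq_one]
        · simp
        · intro k hk
          rw [Finset.mem_range] at hk
          rw [if_neg (by omega), map_one])
    refine ⟨t, fun k hk => ?_, h2⟩
    rw [← h1 k, dif_pos hk]
  choose t h1 h2 using key
  refine splits_iff_of_twist (t := Wreath.base fun x => t x.1 x.2) ?_
  refine Wreath.ext' ?_ ?_
  · rintro ⟨j, i⟩
    simp [stdMono, hw]
  · rintro ⟨j, i⟩
    have ht : t j (finRotate (L j) i : Fin (L j)) = t j (i + 1) := by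
      rw [finRotate_val]
      split_ifs with h
      · rw [h, h2]
      · rfl
    simp only [Wreath.mul_lab, frobMono_lab, Wreath.base_lab, hw, stdMono, Wreath.glue_lab,
      Wreath.base_perm, Equiv.Perm.one_apply, cyc_lab, ht]
    exact h1 j i i.2

end SympTorus

namespace SympTorus
open MonoSL2

/-! ### The centralizer of a product of cycles -/

section centralizer

variable {α M : Type*} [Group M] {L : α → ℕ} {s : α → M}

/-- An element of the centralizer of a product of cycles is determined by its effect on one point
of each cycle. -/
theorem eq_of_commute_glue_cyc (hL : ∀ j, 0 < L j) {A B : Wreath (Σ j, Fin (L j)) M}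
    (hA : A * Wreath.glue (fun j => cyc (L j) (s j)) = Wreath.glue (fun j => cyc (L j) (s j)) * A)
    (hB : B * Wreath.glue (fun j => cyc (L j) (s j)) = Wreath.glue (fun j => cyc (L j) (s j)) * B)
    (hp : ∀ j, A.perm ⟨j, 0, hL j⟩ = B.perm ⟨j, 0, hL j⟩)
    (hl : ∀ j, A.lab ⟨j, 0, hL j⟩ = B.lab ⟨j, 0, hL j⟩) : A = B := by
  set w : Wreath (Σ j, Fin (L j)) M := Wreath.glue fun j => cyc (L j) (s j) with hw
  have key : ∀ j k (hk : k < L j), A.perm ⟨j, k, hk⟩ = B.perm ⟨j, k, hk⟩ ∧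
      A.lab ⟨j, k, hk⟩ = B.lab ⟨j, k, hk⟩ := by
    intro j k
    induction k with
    | zero => exact fun _ => ⟨hp j, hl j⟩
    | succ k ih =>
      intro hk
      obtain ⟨h1, h2⟩ := ih (by omega)
      have hx : (⟨j, k + 1, hk⟩ : Σ j, Fin (L j)) = w.perm ⟨j, k, by omega⟩ := by
        simp only [hw, Wreath.glue_perm, cyc_perm, Sigma.mk.injEq, heq_eq_eq, true_and, Fin.ext_iff,
          finRotate_val]
        rw [if_neg (by omega)]
      have e1 : ∀ C : Wreath (Σ j, Fin (L j)) M, C * w = w * C →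
          C.perm ⟨j, k + 1, hk⟩ = w.perm (C.perm ⟨j, k, by omega⟩) ∧
          C.lab ⟨j, k + 1, hk⟩ = w.lab (C.perm ⟨j, k, by omega⟩) * C.lab ⟨j, k, by omega⟩ *
            (w.lab ⟨j, k, by omega⟩)⁻¹ := by
        intro C hC
        rw [hx]
        constructor
        · have := congrArg (fun D : Wreath (Σ j, Fin (L j)) M => D.perm ⟨j, k, by omega⟩) hC
          exact this
        · have := congrArg (fun D : Wreath (Σ j, Fin (L j)) M => D.lab ⟨j, k, by omega⟩) hC
          exact eq_mul_inv_of_mul_eq this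
      rw [(e1 A hA).1, (e1 B hB).1, (e1 A hA).2, (e1 B hB).2, h1, h2]
      exact ⟨rfl, rfl⟩
  exact Wreath.ext' (fun x => (key x.1 x.2 x.2.2).1) (fun x => (key x.1 x.2 x.2.2).2)

/-- An element of the centralizer of a product of cycles permutes the cycles. -/
theorem block_of_commute_glue_cyc (hL : ∀ j, 0 < L j) {A : Wreath (Σ j, Fin (L j)) M}
    (hA : A * Wreath.glue (fun j => cyc (L j) (s j)) = Wreath.glue (fun j => cyc (L j) (s j)) * A)
    (j : α) (i : Fin (L j)) : (A.perm ⟨j, i⟩).1 = (A.perm ⟨j, 0, hL j⟩).1 := by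
  set w : Wreath (Σ j, Fin (L j)) M := Wreath.glue fun j => cyc (L j) (s j) with hw
  have h1 : (⟨j, i⟩ : Σ j, Fin (L j)) = (w ^ (i : ℕ)).perm ⟨j, 0, hL j⟩ := by
    rw [hw, Wreath.glue_pow_perm, cyc_perm, finRotate_pow_zero]
  have h2 : A * w ^ (i : ℕ) = w ^ (i : ℕ) * A := Commute.pow_right hA _
  have h3 := congrArg (fun D : Wreath (Σ j, Fin (L j)) M => D.perm ⟨j, 0, hL j⟩) h2
  simp only [Wreath.mul_perm, Equiv.Perm.mul_apply] at h3
  rw [h1, h3, hw, Wreath.glue_pow_perm]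

theorem block_inv_of_commute_glue_cyc (hL : ∀ j, 0 < L j) {A : Wreath (Σ j, Fin (L j)) M}
    (hA : A * Wreath.glue (fun j => cyc (L j) (s j)) = Wreath.glue (fun j => cyc (L j) (s j)) * A)
    (j : α) : (A⁻¹.perm ⟨(A.perm ⟨j, 0, hL j⟩).1, 0, hL _⟩).1 = j := by
  have hA' : A⁻¹ * Wreath.glue (fun j => cyc (L j) (s j)) =
      Wreath.glue (fun j => cyc (L j) (s j)) * A⁻¹ := (Commute.inv_left hA)
  rw [← block_of_commute_glue_cyc hL hA' _ (A.perm ⟨j, 0, hL j⟩).2]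
  simp

theorem dvd_of_commute_glue_cyc (hL : ∀ j, 0 < L j) {A : Wreath (Σ j, Fin (L j)) M}
    (hA : A * Wreath.glue (fun j => cyc (L j) (s j)) = Wreath.glue (fun j => cyc (L j) (s j)) * A)
    (j : α) : L (A.perm ⟨j, 0, hL j⟩).1 ∣ L j := by
  have h2 := (show Commute A _ from hA).pow_right (L j)
  have h3 := congrArg (fun D : Wreath (Σ j, Fin (L j)) M => D.perm ⟨j, 0, hL j⟩) h2.eq
  rw [← map_pow] at h3
  simp only [Wreath.mul_perm, Equiv.Perm.mul_apply, Wreath.glue_perm, Pi.pow_apply,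
    Wreath.pow_perm, cyc_perm, finRotate_pow_self, Equiv.Perm.one_apply] at h3
  generalize A.perm ⟨j, 0, hL j⟩ = x at h3 ⊢
  obtain ⟨j', i⟩ := x
  simp only [Sigma.mk.injEq, heq_eq_eq, true_and] at h3
  rw [← zpow_natCast] at h3
  exact Int.natCast_dvd_natCast.mp (dvd_of_finRotate_zpow h3.symm)

theorem length_of_commute_glue_cyc (hL : ∀ j, 0 < L j) {A : Wreath (Σ j, Fin (L j)) M}
    (hA : A * Wreath.glue (fun j => cyc (L j) (s j)) = Wreath.glue (fun j => cyc (L j) (s j)) * A)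
    (j : α) : L (A.perm ⟨j, 0, hL j⟩).1 = L j := by
  refine Nat.dvd_antisymm (dvd_of_commute_glue_cyc hL hA j) ?_
  have h := dvd_of_commute_glue_cyc hL (show A⁻¹ * Wreath.glue (fun j => cyc (L j) (s j)) =
      Wreath.glue (fun j => cyc (L j) (s j)) * A⁻¹ from Commute.inv_left hA)
      (A.perm ⟨j, 0, hL j⟩).1
  rwa [block_inv_of_commute_glue_cyc hL hA j] at h

theorem sign_of_commute_glue_cyc {s : α → ℤˣ} (hL : ∀ j, 0 < L j)
    {A : Wreath (Σ j, Fin (L j)) ℤˣ}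
    (hA : A * Wreath.glue (fun j => cyc (L j) (s j)) = Wreath.glue (fun j => cyc (L j) (s j)) * A)
    (j : α) : s (A.perm ⟨j, 0, hL j⟩).1 = s j := by
  have h2 := (show Commute A _ from hA).pow_right (L j)
  have h3 := congrArg (fun D : Wreath (Σ j, Fin (L j)) ℤˣ => D.lab ⟨j, 0, hL j⟩) h2.eq
  have hlen := length_of_commute_glue_cyc hL hA j
  simp only [Wreath.mul_lab, Wreath.glue_pow_perm, Wreath.glue_pow_lab, cyc_pow_self, cyc_perm,
    finRotate_pow_self, Wreath.base_lab, Equiv.Perm.one_apply] at h3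
  generalize A.perm ⟨j, 0, hL j⟩ = x at h3 hlen ⊢
  generalize A.lab ⟨j, 0, hL j⟩ = c at h3
  obtain ⟨j', i⟩ := x
  simp only at h3 hlen ⊢
  rw [← hlen, cyc_pow_self, mul_comm] at h3
  exact (mul_right_cancel h3).symm

end centralizer

variable {K : Type*} [Field K] {α : Type*} {L ν δ : α → ℕ}

theorem signedPerm_stdMono :
    signedPerm (stdMono K L ν δ) = Wreath.glue fun j => cyc (L j) ((-1) ^ ν j) := by
  simp only [signedPerm, stdMono, Wreath.map_glue, map_cyc, sgn_closingLabel]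

theorem signedPerm_commute {f : K ≃+* K} {y : Mono (Σ j, Fin (L j)) K}
    (h : frobMono f y * stdMono K L ν δ = stdMono K L ν δ * y) :
    signedPerm y * Wreath.glue (fun j => cyc (L j) ((-1) ^ ν j)) =
      Wreath.glue (fun j => cyc (L j) ((-1) ^ ν j)) * signedPerm y := by
  have := congrArg signedPerm h
  rwa [map_mul, map_mul, signedPerm_frobMono, signedPerm_stdMono] at this

/-! ### Matrices with entries `0, 1, -1` -/

theorem anti_one_sq : (anti 1 : MonoSL2 K) ^ 2 = negOne := by
  rw [pow_two]; simp [negOne]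

theorem mem_zpowers_anti_cases {x : MonoSL2 K} (hx : x ∈ Subgroup.zpowers (anti 1 : MonoSL2 K))
    (h : sgn x = 1) : x = 1 ∨ x = negOne := by
  obtain ⟨k, rfl⟩ := Subgroup.mem_zpowers_iff.mp hx
  have hk : Even k := by
    by_contra ho
    rw [map_zpow, sgn_anti, (Int.not_even_iff_odd.mp ho).neg_one_zpow] at h
    exact absurd h (by decide)
  obtain ⟨r, rfl⟩ := hk
  rw [← two_mul, zpow_mul, zpow_ofNat, anti_one_sq]
  have hz : (negOne : MonoSL2 K) ^ (2 : ℤ) = 1 := by rw [zpow_ofNat, pow_two, negOne_mul_negOne]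
  rcases Int.even_or_odd' r with ⟨c, rfl | rfl⟩
  · left; rw [zpow_mul, hz, one_zpow]
  · right; rw [zpow_add, zpow_mul, hz, one_zpow, one_mul, zpow_one]

theorem frob_of_mem_zpowers_anti (f : K ≃+* K) {x : MonoSL2 K}
    (hx : x ∈ Subgroup.zpowers (anti 1 : MonoSL2 K)) : frob f x = x := by
  obtain ⟨k, rfl⟩ := Subgroup.mem_zpowers_iff.mp hx
  rw [map_zpow, frob_anti, map_one]

theorem closingLabel_mem (δ ν : ℕ) :
    closingLabel K δ ν ∈ Subgroup.zpowers (anti 1 : MonoSL2 K) := by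
  refine mul_mem (pow_mem ?_ _) (pow_mem (Subgroup.mem_zpowers _) _)
  rw [← anti_one_sq]
  exact pow_mem (Subgroup.mem_zpowers _) _

/-- The matrices in the centralizer of `w` whose nonzero entries are `±1`. -/
def signCentralizer {ι : Type*} (w : Mono ι K) : Subgroup (Mono ι K) where
  carrier := {A | A * w = w * A ∧ ∀ i, A.lab i ∈ Subgroup.zpowers (anti 1 : MonoSL2 K)}
  one_mem' := ⟨by simp, fun i => one_mem _⟩
  mul_mem' {A B} hA hB := ⟨(show Commute A w from hA.1).mul_left hB.1,
    fun i => mul_mem (hA.2 _) (hB.2 _)⟩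
  inv_mem' {A} hA := ⟨(show Commute A w from hA.1).inv_left, fun i => inv_mem (hA.2 _)⟩

theorem frobMono_of_mem_signCentralizer {ι : Type*} {f : K ≃+* K} {w h : Mono ι K}
    (hh : h ∈ signCentralizer w) : frobMono f h = h :=
  Wreath.ext' (fun _ => rfl) (fun i => frob_of_mem_zpowers_anti f (hh.2 i))

theorem negMono_mem_signCentralizer {ι : Type*} (w : Mono ι K) : negMono ∈ signCentralizer w :=
  ⟨negMono_mul w, fun i => by
    rw [negMono_lab, ← anti_one_sq]
    exact pow_mem (Subgroup.mem_zpowers _) _⟩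

theorem stdMono_mem_signCentralizer :
    stdMono K L ν δ ∈ signCentralizer (stdMono K L ν δ) := by
  refine ⟨rfl, fun x => ?_⟩
  simp only [stdMono, Wreath.glue_lab, cyc_lab]
  split_ifs
  · exact closingLabel_mem _ _
  · exact one_mem _

/-- In characteristic two the permutation matrices form a complement. -/
theorem splits_of_neg_one_eq_one (h2 : (-1 : Kˣ) = 1) (f : K ≃+* K) (L ν δ : α → ℕ) :
    Splits f (stdMono K L ν δ) := by
  have hinj : ∀ x ∈ Subgroup.zpowers (anti 1 : MonoSL2 K), sgn x = 1 → x = 1 := by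
    intro x hx h
    rcases mem_zpowers_anti_cases hx h with h | h
    · exact h
    · rw [h, negOne, h2]; rfl
  refine ⟨signCentralizer (stdMono K L ν δ), fun h hh => ?_, fun h hh hs => Or.inl ?_,
    negMono_mem_signCentralizer _, fun y hy => ?_⟩
  · rw [frobMono_of_mem_signCentralizer hh, hh.1]
  · refine Wreath.ext' (fun i => ?_) (fun i => ?_)
    · rw [← signedPerm_perm, hs]; rfl
    · refine hinj _ (hh.2 i) ?_
      rw [← signedPerm_lab, hs]; rfl
  · let h : Mono (Σ j, Fin (L j)) K :=
      ⟨y.perm, fun i => if sgn (y.lab i) = 1 then 1 else anti 1⟩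
    have hmem : ∀ i, h.lab i ∈ Subgroup.zpowers (anti 1 : MonoSL2 K) := fun i => by
      simp only [h]
      split_ifs
      · exact one_mem _
      · exact Subgroup.mem_zpowers _
    have hs : signedPerm h = signedPerm y := by
      refine Wreath.ext' (fun i => rfl) (fun i => ?_)
      simp only [h, signedPerm_lab]
      rcases Int.units_eq_one_or (sgn (y.lab i)) with h | h <;> simp [h]
    refine ⟨h, ⟨?_, hmem⟩, hs⟩
    have hc := signedPerm_commute hy
    rw [← hs, ← signedPerm_stdMono (K := K) (δ := δ), ← map_mul, ← map_mul] at hc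
    refine Wreath.ext' (fun i => ?_) (fun i => ?_)
    · exact congrArg (fun D : Wreath (Σ j, Fin (L j)) ℤˣ => D.perm i) hc
    · have h3 := congrArg (fun D : Wreath (Σ j, Fin (L j)) ℤˣ => D.lab i) hc
      simp only [signedPerm_lab] at h3
      rw [← mul_inv_eq_one]
      refine hinj _ (mul_mem (mul_mem (hmem _) (stdMono_mem_signCentralizer.2 _))
        (inv_mem (mul_mem (stdMono_mem_signCentralizer.2 _) (hmem _)))) ?_
      rw [map_mul, map_inv, mul_inv_eq_one]
      exact h3

/-- For a single cycle the matrices with entries `0, ±1` form a complement modulo `±1`. -/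
theorem splits_of_subsingleton [Subsingleton α] [Nonempty α] (f : K ≃+* K) (hL : ∀ j, 0 < L j) :
    Splits f (stdMono K L ν δ) := by
  obtain ⟨j₀⟩ := ‹Nonempty α›
  refine ⟨signCentralizer (stdMono K L ν δ), fun h hh => ?_, fun h hh hs => ?_,
    negMono_mem_signCentralizer _, fun y hy => ?_⟩
  · rw [frobMono_of_mem_signCentralizer hh, hh.1]
  · have hp : h.perm = 1 := by rw [← signedPerm_perm, hs]; rfl
    have hl : sgn (h.lab ⟨j₀, 0, hL j₀⟩) = 1 := by rw [← signedPerm_lab, hs]; rfl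
    rcases mem_zpowers_anti_cases (hh.2 _) hl with h1 | h1
    · refine Or.inl (eq_of_commute_glue_cyc hL hh.1 (by simp) (fun j => by simp [hp]) ?_)
      intro j
      obtain rfl := Subsingleton.elim j j₀
      simp [h1]
    · refine Or.inr (eq_of_commute_glue_cyc hL hh.1 (negMono_mul _) (fun j => by simp [hp]) ?_)
      intro j
      obtain rfl := Subsingleton.elim j j₀
      simp [h1]
  · let J : Mono (Σ j, Fin (L j)) K := Wreath.base fun _ => anti 1
    have hJ : J ∈ signCentralizer (stdMono K L ν δ) := by
      refine ⟨Wreath.ext' (fun i => by simp [J]) (fun i => ?_), fun i => Subgroup.mem_zpowers _⟩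
      have h1 := (stdMono_mem_signCentralizer (K := K) (L := L) (ν := ν) (δ := δ)).2 i
      have h2 : (anti 1 : MonoSL2 K) ∈ Subgroup.zpowers (anti 1 : MonoSL2 K) :=
        Subgroup.mem_zpowers _
      simp only [J, Wreath.mul_lab, Wreath.base_lab, Wreath.base_perm, Equiv.Perm.one_apply]
      obtain ⟨k, hk⟩ := Subgroup.mem_zpowers_iff.mp h1
      rw [← hk]
      exact (Commute.refl (anti 1 : MonoSL2 K)).zpow_right k
    obtain ⟨a, ha⟩ : ∃ a : ℕ, (-1 : ℤˣ) ^ a = sgn (y.lab ⟨j₀, 0, hL j₀⟩) := by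
      rcases Int.units_eq_one_or (sgn (y.lab ⟨j₀, 0, hL j₀⟩)) with h | h
      · exact ⟨0, by simp [h]⟩
      · exact ⟨1, by simp [h]⟩
    obtain ⟨i, hi⟩ : ∃ i, y.perm ⟨j₀, 0, hL j₀⟩ = ⟨j₀, i⟩ := by
      generalize y.perm ⟨j₀, 0, hL j₀⟩ = x
      obtain ⟨j, i⟩ := x
      obtain rfl := Subsingleton.elim j j₀
      exact ⟨i, rfl⟩
    have hh := mul_mem (pow_mem hJ a)
      (pow_mem (stdMono_mem_signCentralizer (K := K) (L := L) (ν := ν) (δ := δ)) (i : ℕ))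
    refine ⟨_, hh, ?_⟩
    refine eq_of_commute_glue_cyc hL (s := fun j => (-1) ^ ν j) ?_ (signedPerm_commute hy) ?_ ?_
    · refine signedPerm_commute (f := f) (δ := δ) ?_
      rw [frobMono_of_mem_signCentralizer hh, hh.1]
    · intro j
      obtain rfl := Subsingleton.elim j j₀
      rw [signedPerm_perm, signedPerm_perm, hi]
      rw [Wreath.mul_perm, Equiv.Perm.mul_apply, stdMono, Wreath.glue_pow_perm, cyc_perm,
        finRotate_pow_zero, ← map_pow, Wreath.base_perm]
      rfl
    · intro j
      obtain rfl := Subsingleton.elim j j₀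
      rw [map_mul, map_pow, map_pow, signedPerm_stdMono,
        signedPerm_lab y, ← ha, Wreath.mul_lab, Wreath.glue_pow_lab,
        cyc_pow_lab _ i.2.le, if_neg (by simp), mul_one]
      have : signedPerm J = Wreath.base fun _ => -1 :=
        Wreath.ext' (fun i => by simp [J]) (fun i => by simp [J])
      rw [this, ← map_pow, Wreath.base_lab]
      rfl

/-! ### Necessary conditions -/

/-- In a complement the negation of a single cycle is represented by a matrix whose square is `-1`;
on the other cycles it is diagonal with entries of square `-1`. -/
theorem exists_negation (h2 : (-1 : Kˣ) ≠ 1) {f : K ≃+* K}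
    (hL : ∀ j, 0 < L j) {H : Subgroup (Mono (Σ j, Fin (L j)) K)}
    (hb : ∀ h ∈ H, signedPerm h = 1 → h = 1 ∨ h = negMono)
    (hd : ∀ y, frobMono f y * stdMono K L ν δ = stdMono K L ν δ * y →
      ∃ h ∈ H, signedPerm h = signedPerm y) (j₀ : α) :
    ∃ h ∈ H, h.perm = 1 ∧ (∀ i, ∃ a, h.lab ⟨j₀, i⟩ = anti a) ∧
      ∀ j i, j ≠ j₀ → ∃ c, h.lab ⟨j, i⟩ = diag c ∧ c * c = -1 := by
  classical
  obtain ⟨h, hh, hs⟩ := hd (Wreath.base fun x => if x.1 = j₀ then anti 1 else 1) (by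
    refine Wreath.ext' (fun i => by simp) (fun x => ?_)
    have hx : ((stdMono K L ν δ).perm x).1 = x.1 := rfl
    simp only [Wreath.mul_lab, frobMono_lab, Wreath.base_lab, hx, Wreath.base_perm,
      Equiv.Perm.one_apply]
    split_ifs
    · obtain ⟨k, hk⟩ := Subgroup.mem_zpowers_iff.mp
        ((stdMono_mem_signCentralizer (K := K) (L := L) (ν := ν) (δ := δ)).2 x)
      rw [← hk, frob_anti, map_one]
      exact (Commute.refl (anti 1 : MonoSL2 K)).zpow_right k
    · simp)
  have hp : h.perm = 1 := by rw [← signedPerm_perm, hs]; rfl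
  have hl : ∀ x, sgn (h.lab x) = if x.1 = j₀ then -1 else 1 := fun x => by
    rw [← signedPerm_lab, hs]
    simp only [signedPerm_lab, Wreath.base_lab]
    split_ifs <;> rfl
  have h1 : ∀ i, ∃ a, h.lab ⟨j₀, i⟩ = anti a := fun i => sgn_eq_neg_one (by rw [hl, if_pos rfl])
  have hsq : h * h = negMono := by
    refine (hb _ (mul_mem hh hh) ?_).resolve_left fun h3 => ?_
    · refine Wreath.ext' (fun i => by simp [hp]) (fun i => ?_)
      rw [signedPerm_lab, Wreath.mul_lab, hp, Equiv.Perm.one_apply, map_mul, hl]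
      split_ifs <;> rfl
    · obtain ⟨a, ha⟩ := h1 ⟨0, hL j₀⟩
      have := congrArg (fun D : Mono (Σ j, Fin (L j)) K => D.lab ⟨j₀, 0, hL j₀⟩) h3
      simp only [Wreath.mul_lab, hp, Equiv.Perm.one_apply, ha, anti_mul_anti, Wreath.one_lab,
        one_def, diag.injEq] at this
      exact h2 (by simpa using this)
  refine ⟨h, hh, hp, h1, fun j i hj => ?_⟩
  obtain ⟨c, hc⟩ := sgn_eq_one (x := h.lab ⟨j, i⟩) (by rw [hl, if_neg hj])
  have := congrArg (fun D : Mono (Σ j, Fin (L j)) K => D.lab ⟨j, i⟩) hsq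
  simp only [Wreath.mul_lab, hp, Equiv.Perm.one_apply, hc, diag_mul_diag, negMono_lab, negOne,
    diag.injEq] at this
  exact ⟨c, hc, this⟩

/-- A cycle besides another one carries a diagonal matrix of order four that is fixed by the
twisted Frobenius map; this restricts its length. -/
theorem parity_of_splits (h2 : (-1 : Kˣ) ≠ 1) {f : K ≃+* K} {κ : ℕ}
    (hf : ∀ c : Kˣ, c * c = -1 → Units.map (f : K →* K) c = (-1) ^ κ * c)
    (hL : ∀ j, 0 < L j) (h : Splits f (stdMono K L ν δ)) {j j₀ : α} (hj : j ≠ j₀) :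
    (-1 : Kˣ) ^ (κ * L j) = (-1) ^ ν j := by
  obtain ⟨H, ha, hb, -, hd⟩ := h
  obtain ⟨h, hh, hp, -, hc⟩ := exists_negation h2 hL hb hd j₀
  have hfix := ha h hh
  choose c hc using fun i => hc j i hj
  have hstep : ∀ i, diag (Units.map (f : K →* K) (c (finRotate _ i))) *
      (stdMono K L ν δ).lab ⟨j, i⟩ = (stdMono K L ν δ).lab ⟨j, i⟩ * diag (c i) := fun i => by
    have := congrArg (fun D : Mono (Σ j, Fin (L j)) K => D.lab ⟨j, i⟩) hfix
    simp only [Wreath.mul_lab, frobMono_lab, hp, Equiv.Perm.one_apply, (hc i).1] at this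
    rw [← this]
    have h3 : (stdMono K L ν δ).perm ⟨j, i⟩ = ⟨j, finRotate _ i⟩ := rfl
    rw [h3, (hc _).1]
    rfl
  have hsq : ((-1 : Kˣ) ^ κ) * (-1) ^ κ = 1 := by rw [← mul_pow]; simp
  have hc0 : ∀ k (hk : k < L j), c ⟨k, hk⟩ = (-1) ^ (κ * k) * c ⟨0, hL j⟩ := by
    intro k
    induction k with
    | zero => simp
    | succ k ih =>
      intro hk
      have h4 := hstep ⟨k, by omega⟩
      have h5 : finRotate (L j) ⟨k, by omega⟩ = ⟨k + 1, hk⟩ :=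
        Fin.ext (by rw [finRotate_val, if_neg (by simp; omega)])
      simp only [stdMono, Wreath.glue_lab, cyc_lab] at h4
      rw [if_neg (by omega), mul_one, one_mul, diag.injEq, h5, hf _ (hc _).2] at h4
      rw [mul_add, pow_add, mul_one, mul_comm (_ ^ _) (_ ^ κ), mul_assoc, ← ih (by omega), ← h4,
        ← mul_assoc, hsq, one_mul]
  have h4 := hstep ⟨L j - 1, by have := hL j; omega⟩
  have hcl : ∀ x : Kˣ, x * x = -1 →
      closingLabel K (δ j) (ν j) * diag x = diag ((-1) ^ ν j * x) * closingLabel K (δ j) (ν j) := by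
    intro x hx
    have hA : anti 1 * diag x = diag (-x) * anti (1 : Kˣ) := by
      have : (-x)⁻¹ = x := inv_eq_of_mul_eq_one_right (by rw [neg_mul, hx, neg_neg])
      simp [this]
    have hN : ∀ n : ℕ, anti (1 : Kˣ) ^ n * diag x = diag ((-1) ^ n * x) * anti 1 ^ n := by
      intro n
      induction n with
      | zero => simp
      | succ n ih =>
        have : negOne * anti (1 : Kˣ) ^ n = anti 1 ^ n * negOne := negOne_mul _
        have e : diag (-x) = negOne * diag x := by simp [negOne]
        rw [pow_succ, mul_assoc, hA, e, ← mul_assoc, ← mul_assoc, ← this, mul_assoc negOne, ih]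
        simp only [← mul_assoc]
        simp [negOne, pow_succ]
    have hZ : (negOne : MonoSL2 K) ^ δ j * diag ((-1) ^ ν j * x) =
        diag ((-1) ^ ν j * x) * negOne ^ δ j :=
      Commute.pow_left (negOne_mul _) _
    rw [closingLabel, mul_assoc, hN, ← mul_assoc, hZ, mul_assoc]
  have h5 : finRotate (L j) ⟨L j - 1, by have := hL j; omega⟩ = ⟨0, hL j⟩ :=
    Fin.ext (by rw [finRotate_val, if_pos (by have := hL j; simp; omega)])
  simp only [stdMono, Wreath.glue_lab, cyc_lab] at h4
  rw [if_pos (by have := hL j; omega), hcl _ (hc _).2] at h4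
  have h6 := mul_right_cancel h4
  rw [diag.injEq, h5, hf _ (hc _).2, hc0 (L j - 1), ← mul_assoc] at h6
  have h7 := mul_right_cancel h6
  calc (-1 : Kˣ) ^ (κ * L j) = (-1) ^ κ * (-1) ^ (κ * (L j - 1)) := by
        rw [← pow_add, ← mul_one_add]
        congr 2
        have := hL j; omega
    _ = (-1) ^ ν j := by
        rw [h7, mul_assoc, ← pow_add]
        have : Even (κ * (L j - 1) + κ * (L j - 1)) := ⟨_, rfl⟩
        simp

/-- The negations of two cycles anticommute there, but commute on a third cycle. -/
theorem not_splits_of_three (h2 : (-1 : Kˣ) ≠ 1) {f : K ≃+* K} (hL : ∀ j, 0 < L j)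
    {j₁ j₂ j₃ : α} (h12 : j₁ ≠ j₂) (h13 : j₁ ≠ j₃) (h23 : j₂ ≠ j₃) :
    ¬ Splits f (stdMono K L ν δ) := by
  rintro ⟨H, ha, hb, -, hd⟩
  obtain ⟨x, hx, hxp, hx1, hx2⟩ := exists_negation h2 hL hb hd j₁
  obtain ⟨y, hy, hyp, hy1, hy2⟩ := exists_negation h2 hL hb hd j₂
  have hcomm : x * y = negMono * (y * x) := by
    have hmem : x * y * (y * x)⁻¹ ∈ H := mul_mem (mul_mem hx hy) (inv_mem (mul_mem hy hx))
    have hs : signedPerm (x * y * (y * x)⁻¹) = 1 := by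
      rw [map_mul, map_inv, mul_inv_eq_one]
      refine Wreath.ext' (fun i => by simp [hxp, hyp]) (fun i => ?_)
      simp [hxp, hyp, mul_comm]
    rcases hb _ hmem hs with h | h
    · exfalso
      rw [mul_inv_eq_one] at h
      obtain ⟨a, ha⟩ := hx1 ⟨0, hL j₁⟩
      obtain ⟨c, hc, hcc⟩ := hy2 j₁ ⟨0, hL j₁⟩ h12
      have := congrArg (fun D : Mono (Σ j, Fin (L j)) K => D.lab ⟨j₁, 0, hL j₁⟩) h
      simp only [Wreath.mul_lab, hxp, hyp, Equiv.Perm.one_apply, ha, hc, anti_mul_diag,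
        diag_mul_anti, anti.injEq] at this
      rw [mul_comm, mul_left_inj, eq_inv_iff_mul_eq_one, hcc] at this
      exact h2 this
    · rwa [mul_inv_eq_iff_eq_mul] at h
  obtain ⟨c, hc, -⟩ := hx2 j₃ ⟨0, hL j₃⟩ h13.symm
  obtain ⟨d, hd, -⟩ := hy2 j₃ ⟨0, hL j₃⟩ h23.symm
  have := congrArg (fun D : Mono (Σ j, Fin (L j)) K => D.lab ⟨j₃, 0, hL j₃⟩) hcomm
  simp only [Wreath.mul_lab, hxp, hyp, Equiv.Perm.one_apply, hc, hd, diag_mul_diag, negMono_lab,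
    Wreath.mul_perm, mul_one, negOne, diag.injEq] at this
  rw [mul_comm d c, right_eq_mul] at this
  exact h2 this

end SympTorus

namespace SympTorus
open MonoSL2

/-! ### Groups generated by elements that commute up to a central element -/

/-- Four elements that commute modulo a central cyclic group generate a group whose elements have
the obvious normal form. -/
theorem exists_normal_form {B : Type*} [Group B] {Z t₀ f₀ t₁ f₁ : B} (hZ : ∀ x, Z * x = x * Z)
    (h₀ : Commute t₀ f₀) (h₁ : Commute t₁ f₁) (htt : ∃ c : ℕ, t₀ * t₁ = Z ^ c * (t₁ * t₀))
    (htf : ∃ c : ℕ, t₀ * f₁ = Z ^ c * (f₁ * t₀)) (hft : ∃ c : ℕ, f₀ * t₁ = Z ^ c * (t₁ * f₀))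
    (hff : ∃ c : ℕ, f₀ * f₁ = Z ^ c * (f₁ * f₀)) {x : B}
    (hx : x ∈ Subgroup.closure ({Z, t₀, f₀, t₁, f₁} : Set B)) :
    ∃ c a₀ b₀ a₁ b₁ : ℤ, x = Z ^ c * (t₀ ^ a₀ * f₀ ^ b₀ * (t₁ ^ a₁ * f₁ ^ b₁)) := by
  have : (Subgroup.zpowers Z).Normal := ⟨fun y hy g => by
    obtain ⟨k, rfl⟩ := Subgroup.mem_zpowers_iff.mp hy
    have : Commute g (Z ^ k) := Commute.zpow_right (hZ g).symm k
    rw [this.eq, mul_inv_cancel_right]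
    exact hy⟩
  let mk := QuotientGroup.mk' (Subgroup.zpowers Z)
  have hmkZ : mk Z = 1 := (QuotientGroup.eq_one_iff Z).mpr (Subgroup.mem_zpowers Z)
  have hcomm : ∀ {x y : B}, (∃ c : ℕ, x * y = Z ^ c * (y * x)) → Commute (mk x) (mk y) := by
    rintro x y ⟨c, h⟩
    have := congrArg mk h
    rwa [map_mul, map_mul, map_pow, hmkZ, one_pow, one_mul, map_mul] at this
  have k₀ := h₀.map mk
  have k₁ := h₁.map mk
  let g₀ := (zpowersHom _ (mk t₀)).noncommCoprod (zpowersHom _ (mk f₀))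
    fun m n => k₀.zpow_zpow _ _
  let g₁ := (zpowersHom _ (mk t₁)).noncommCoprod (zpowersHom _ (mk f₁))
    fun m n => k₁.zpow_zpow _ _
  let g := g₀.noncommCoprod g₁ fun m n =>
    (((hcomm htt).zpow_zpow _ _).mul_right ((hcomm htf).zpow_zpow _ _)).mul_left
      (((hcomm hft).zpow_zpow _ _).mul_right ((hcomm hff).zpow_zpow _ _))
  have hg : ∀ a₀ b₀ a₁ b₁ : ℤ, g ((Multiplicative.ofAdd a₀, Multiplicative.ofAdd b₀),
      (Multiplicative.ofAdd a₁, Multiplicative.ofAdd b₁)) =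
      mk (t₀ ^ a₀ * f₀ ^ b₀ * (t₁ ^ a₁ * f₁ ^ b₁)) := fun a₀ b₀ a₁ b₁ => by
    simp only [map_mul, map_zpow]
    rfl
  have hle : Subgroup.closure ({Z, t₀, f₀, t₁, f₁} : Set B) ≤ g.range.comap mk := by
    rw [Subgroup.closure_le]
    rintro y (rfl | rfl | rfl | rfl | rfl)
    · exact ⟨1, by rw [map_one, hmkZ]⟩
    · exact ⟨_, (hg 1 0 0 0).trans (by simp)⟩
    · exact ⟨_, (hg 0 1 0 0).trans (by simp)⟩
    · exact ⟨_, (hg 0 0 1 0).trans (by simp)⟩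
    · exact ⟨_, (hg 0 0 0 1).trans (by simp)⟩
  obtain ⟨⟨⟨a₀, b₀⟩, a₁, b₁⟩, h⟩ := hle hx
  rw [show g ((a₀, b₀), a₁, b₁) = _ from hg a₀.toAdd b₀.toAdd a₁.toAdd b₁.toAdd] at h
  obtain ⟨c, hc⟩ := Subgroup.mem_zpowers_iff.mp (QuotientGroup.eq.mp h)
  have hc' : ∀ y, Commute (Z ^ c) y := fun y => Commute.zpow_left (hZ y) c
  refine ⟨c, a₀.toAdd, b₀.toAdd, a₁.toAdd, b₁.toAdd, ?_⟩
  rw [(hc' _).eq, hc, mul_inv_cancel_left]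

/-- A subgroup that is normalized by an involution `P` and its translate by `P` form a subgroup. -/
theorem exists_subgroup_adjoin_involution {G : Type*} [Group G] (H : Subgroup G) {P : G}
    (hP : P * P = 1) (hH : ∀ h ∈ H, P * h * P ∈ H) :
    ∃ H' : Subgroup G, ∀ y, y ∈ H' ↔ y ∈ H ∨ P * y ∈ H := by
  have hPP : ∀ x, P * (P * x) = x := fun x => by rw [← mul_assoc, hP, one_mul]
  refine ⟨⟨⟨⟨{y | y ∈ H ∨ P * y ∈ H}, ?_⟩, Or.inl (one_mem _)⟩, ?_⟩, fun _ => Iff.rfl⟩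
  · rintro x y (hx | hx) (hy | hy)
    · exact Or.inl (mul_mem hx hy)
    · refine Or.inr ?_
      have := mul_mem (hH x hx) hy
      rwa [mul_assoc, hPP, mul_assoc] at this
    · refine Or.inr ?_
      rw [← mul_assoc]
      exact mul_mem hx hy
    · refine Or.inl ?_
      have := mul_mem (hH _ hx) hy
      rwa [hPP, mul_assoc, hPP] at this
  · rintro x (hx | hx)
    · exact Or.inl (inv_mem hx)
    · refine Or.inr ?_
      have := hH _ (inv_mem hx)
      rwa [mul_inv_rev, inv_eq_of_mul_eq_one_right hP, mul_assoc, mul_assoc, hP, mul_one] at this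

/-! ### Two cycles -/

section block

variable {K : Type*} [Field K] {n κ ν δ : ℕ} {i : Kˣ}

/-- The matrix that interchanges the two isotropic subspaces of a cycle. -/
def flip (K : Type*) [Field K] (n : ℕ) : Mono (Fin n) K := Wreath.base fun _ => anti 1

/-- The diagonal matrix with entries `i, (-1) ^ κ i, i, …` and their inverses. -/
def quarter (n κ : ℕ) (i : Kˣ) : Mono (Fin n) K :=
  Wreath.base fun k => diag ((-1) ^ (κ * k) * i)

/-- The standard monomial matrix of a single cycle. -/
abbrev stdCyc (K : Type*) [Field K] (n ν δ : ℕ) : Mono (Fin n) K := cyc n (closingLabel K δ ν)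

theorem negMono_pow_mul (A : Mono (Fin n) K) (k : ℕ) : negMono ^ k * A = A * negMono ^ k :=
  Commute.pow_left (negMono_mul A) k

theorem negMono_pow_mul_self (k : ℕ) : (negMono : Mono (Fin n) K) ^ k * negMono ^ k = 1 := by
  rw [← (Commute.refl _).mul_pow, negMono_mul_negMono, one_pow]

theorem flip_mul_flip : flip K n * flip K n = negMono :=
  Wreath.ext' (fun k => by simp [flip]) (fun k => by simp [flip, negOne])

theorem quarter_mul_quarter (hi : i * i = -1) :
    quarter n κ i * quarter n κ i = negMono :=
  Wreath.ext' (fun k => by simp [quarter]) (fun k => by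
    have : ((-1 : Kˣ) ^ (κ * k)) * (-1) ^ (κ * k) = 1 := by rw [← mul_pow]; simp
    simp only [quarter, negOne, Wreath.mul_lab, Wreath.base_lab, Wreath.base_perm,
      Equiv.Perm.one_apply, diag_mul_diag, negMono_lab]
    rw [mul_mul_mul_comm, this, hi, one_mul])

theorem flip_mul_quarter (hi : i * i = -1) :
    flip K n * quarter n κ i = negMono * (quarter n κ i * flip K n) :=
  Wreath.ext' (fun k => by simp [flip, quarter]) (fun k => by
    have : i⁻¹ = -i := inv_eq_of_mul_eq_one_right (by rw [mul_neg, hi, neg_neg])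
    have h1 : ((-1 : Kˣ) ^ (κ * k))⁻¹ = (-1) ^ (κ * k) := by rw [← inv_pow]; simp
    simp [flip, quarter, negOne, this, h1, mul_comm])

theorem stdCyc_mul_flip : stdCyc K n ν δ * flip K n = flip K n * stdCyc K n ν δ :=
  Wreath.ext' (fun k => by simp [flip]) (fun k => by
    obtain ⟨r, hr⟩ := Subgroup.mem_zpowers_iff.mp (closingLabel_mem (K := K) δ ν)
    simp only [flip, Wreath.mul_lab, Wreath.base_lab, Wreath.base_perm, Equiv.Perm.one_apply,
      cyc_lab, ← hr]
    split_ifs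
    · exact ((Commute.refl (anti 1 : MonoSL2 K)).zpow_right r).symm
    · simp)

theorem closingLabel_mul_diag (hi : i * i = -1) :
    closingLabel K δ ν * diag i = negOne ^ ν * (diag i * closingLabel K δ ν) := by
  have h1 : (anti 1 : MonoSL2 K) * diag i = negOne * (diag i * anti 1) := by
    have : i⁻¹ = -i := inv_eq_of_mul_eq_one_right (by rw [mul_neg, hi, neg_neg])
    simp [negOne, this]
  have h2 : (anti 1 : MonoSL2 K) ^ ν * diag i = negOne ^ ν * (diag i * anti 1 ^ ν) := by
    induction ν with
    | zero => simp
    | succ ν ih =>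
      have h3 : (anti 1 : MonoSL2 K) ^ ν * negOne = negOne * anti 1 ^ ν := (negOne_mul _).symm
      rw [pow_succ, mul_assoc, h1, ← mul_assoc, h3, mul_assoc, ← mul_assoc _ (diag i), ih,
        pow_succ' negOne]
      simp only [mul_assoc]
  have h4 : ∀ x : MonoSL2 K, negOne ^ δ * x = x * negOne ^ δ :=
    fun x => Commute.pow_left (negOne_mul x) δ
  rw [closingLabel, mul_assoc, h2, h4, h4]
  simp only [mul_assoc]

theorem stdCyc_mul_quarter (hi : i * i = -1) (hν : κ * n = ν + 2 * δ) :
    stdCyc K n ν δ * quarter n κ i = negMono ^ κ * (quarter n κ i * stdCyc K n ν δ) := by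
  have hz : (negMono : Mono (Fin n) K) ^ κ = Wreath.base fun _ => diag ((-1) ^ κ) := by
    rw [negMono, ← map_pow]
    congr 1
    funext _
    exact negOne_pow κ
  have hsq : ((-1 : Kˣ) ^ κ) * (-1) ^ κ = 1 := by rw [← mul_pow]; simp
  rw [hz]
  refine Wreath.ext' (fun k => by simp [quarter]) (fun k => ?_)
  simp only [quarter, Wreath.mul_lab, Wreath.base_lab, Wreath.base_perm, Equiv.Perm.one_apply,
    Wreath.mul_perm, one_mul, cyc_perm, cyc_lab, finRotate_val]
  split_ifs with h
  · have hp : ∀ x : Kˣ, closingLabel K δ ν * diag (x * i) =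
        (closingLabel K δ ν * diag x) * diag i := fun x => by rw [mul_assoc, diag_mul_diag]
    have hcomm : closingLabel K δ ν * diag ((-1) ^ (κ * k)) =
        diag ((-1) ^ (κ * k)) * closingLabel K δ ν := by
      rw [← negOne_pow]
      exact (Commute.pow_left (negOne_mul _) _).symm
    rw [hp, hcomm, mul_assoc, closingLabel_mul_diag hi, negOne_pow, mul_zero, pow_zero, one_mul,
      ← mul_assoc, diag_mul_diag, ← pow_add]
    congr 2
    have : κ * k + ν + 2 * δ = κ * k + κ * n := by omega
    have e : κ * k + κ * n = κ * (2 * k) + κ := by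
      calc κ * k + κ * n = κ * k + κ * (k + 1) := by rw [h]
        _ = _ := by ring
    calc (-1 : Kˣ) ^ (κ * k + ν) = (-1) ^ (κ * k + ν + 2 * δ) := by
          rw [pow_add _ (κ * k + ν) (2 * δ), pow_mul]; simp
      _ = (-1) ^ κ := by
          rw [this, e, pow_add, mul_left_comm, pow_mul _ 2]; simp
  · simp only [one_mul, mul_one, diag_mul_diag, diag.injEq]
    have e : ∀ c a : Kˣ, c * (a * c * i) = c * c * (a * i) := fun c a => by ac_rfl
    rw [mul_add, pow_add, mul_one, e, hsq, one_mul]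

theorem stdCyc_pow : (stdCyc K n ν δ) ^ n = negMono ^ δ * flip K n ^ ν := by
  rw [cyc_pow_self, negMono, flip, ← map_pow, ← map_pow, ← map_mul]
  rfl

theorem frobMono_flip (f : K ≃+* K) : frobMono f (flip K n) = flip K n :=
  Wreath.ext' (fun k => by simp [flip]) (fun k => by simp [flip])

theorem frobMono_stdCyc (f : K ≃+* K) : frobMono f (stdCyc K n ν δ) = stdCyc K n ν δ := by
  simp only [frobMono, map_cyc]
  simp

theorem frobMono_quarter {f : K ≃+* K} (hf : Units.map (f : K →* K) i = (-1) ^ κ * i) :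
    frobMono f (quarter n κ i) = negMono ^ κ * quarter n κ i := by
  rw [negMono, ← map_pow]
  refine Wreath.ext' (fun k => by simp [quarter]) (fun k => ?_)
  simp only [quarter, frobMono_lab, Wreath.base_lab, Wreath.mul_lab, Wreath.base_perm,
    Equiv.Perm.one_apply, Pi.pow_apply, frob_diag, negOne_pow, diag_mul_diag, diag.injEq]
  rw [map_mul]
  erw [hf]
  rw [map_pow, mul_left_comm]
  congr 2
  exact Units.ext (by simp)

theorem signedPerm_quarter : signedPerm (quarter n κ i) = 1 :=
  Wreath.ext' (fun k => by simp [quarter]) (fun k => by simp [quarter])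

theorem signedPerm_flip : signedPerm (flip K n) = Wreath.base fun _ => -1 :=
  Wreath.ext' (fun k => by simp [flip]) (fun k => by simp [flip])

theorem signedPerm_stdCyc : signedPerm (stdCyc K n ν δ) = cyc n ((-1) ^ ν) := by
  simp only [signedPerm, map_cyc, sgn_closingLabel]

theorem mul_quarter_pow {b : Mono (Fin n) K} {e : ℕ}
    (h : b * quarter n κ i = negMono ^ e * (quarter n κ i * b)) (r : ℕ) :
    b * quarter n κ i ^ r = negMono ^ (e * r) * (quarter n κ i ^ r * b) := by
  induction r with
  | zero => simp
  | succ r ih =>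
    rw [pow_succ, ← mul_assoc, ih, mul_assoc, mul_assoc, h, ← mul_assoc _ (negMono ^ e),
      ← negMono_pow_mul, mul_add, mul_one, pow_add]
    simp only [mul_assoc]

end block
end SympTorus

namespace SympTorus
open MonoSL2

section pair

variable {K : Type*} [Field K]

/-- The element that acts by `b` on the cycle number `j` and by the `e`-th power of the diagonal
matrix of order four on the other cycle. -/
def crossed {L : Fin 2 → ℕ} (κ : ℕ) (i : Kˣ) (b : ∀ j, Mono (Fin (L j)) K) (e : ℕ) (j : Fin 2) :
    ∀ k, Mono (Fin (L k)) K :=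
  fun k => if k = j then b k else quarter (L k) κ i ^ e

variable {L ν δ : Fin 2 → ℕ} {κ : ℕ} {i : Kˣ}

theorem crossed_same (b : ∀ j, Mono (Fin (L j)) K) (e : ℕ) (j : Fin 2) :
    crossed κ i b e j j = b j := if_pos rfl

theorem crossed_ne (b : ∀ j, Mono (Fin (L j)) K) (e : ℕ) {j k : Fin 2} (h : k ≠ j) :
    crossed κ i b e j k = quarter (L k) κ i ^ e := if_neg h

/-- The element `-1` as a pair. -/
abbrev negPair (K : Type*) [Field K] (L : Fin 2 → ℕ) : ∀ k, Mono (Fin (L k)) K := fun _ => negMono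

theorem negPair_mul (x : ∀ k, Mono (Fin (L k)) K) : negPair K L * x = x * negPair K L :=
  funext fun k => negMono_mul (x k)

theorem crossed_commute {b b' : ∀ j, Mono (Fin (L j)) K} (e e' : ℕ) {j : Fin 2}
    (h : Commute (b j) (b' j)) : Commute (crossed κ i b e j) (crossed κ i b' e' j) := by
  funext k
  by_cases hk : k = j
  · subst hk
    simpa only [Pi.mul_apply, crossed_same] using h.eq
  · simp only [Pi.mul_apply, crossed_ne _ _ hk]
    exact ((Commute.refl _).pow_pow _ _)

/-- The signs from the two cycles agree, so that elements that belong to different cycles commute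
modulo `-1`. -/
theorem crossed_mul {b b' : ∀ j, Mono (Fin (L j)) K} {e e' : ℕ}
    (hb : ∀ j, b j * quarter (L j) κ i = negMono ^ e * (quarter (L j) κ i * b j))
    (hb' : ∀ j, b' j * quarter (L j) κ i = negMono ^ e' * (quarter (L j) κ i * b' j)) :
    ∃ c : ℕ, crossed κ i b e 0 * crossed κ i b' e' 1 =
      negPair K L ^ c * (crossed κ i b' e' 1 * crossed κ i b e 0) := by
  refine ⟨e * e', funext (Fin.forall_fin_two.mpr ⟨?_, ?_⟩)⟩
  · simp only [Pi.mul_apply, Pi.pow_apply, crossed_same,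
      crossed_ne b' e' (show (0 : Fin 2) ≠ 1 by decide)]
    exact mul_quarter_pow (hb 0) e'
  · simp only [Pi.mul_apply, Pi.pow_apply, crossed_same,
      crossed_ne b e (show (1 : Fin 2) ≠ 0 by decide)]
    rw [mul_quarter_pow (hb' 1) e, ← mul_assoc, mul_comm e', negMono_pow_mul_self, one_mul]

/-- The representative of the negation of the cycle number `j`. -/
abbrev crossedFlip (L : Fin 2 → ℕ) (κ : ℕ) (i : Kˣ) (j : Fin 2) : ∀ k, Mono (Fin (L k)) K :=
  crossed κ i (fun j => flip K (L j)) 1 j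

/-- The representative of the cycle number `j`. -/
abbrev crossedCyc (L ν δ : Fin 2 → ℕ) (κ : ℕ) (i : Kˣ) (j : Fin 2) : ∀ k, Mono (Fin (L k)) K :=
  crossed κ i (fun j => stdCyc K (L j) (ν j) (δ j)) κ j

/-- The group generated by the representatives of the generators of the centralizer of two cycles,
not counting the interchange of the cycles. -/
def crossedGroup (L ν δ : Fin 2 → ℕ) (κ : ℕ) (i : Kˣ) : Subgroup (∀ k, Mono (Fin (L k)) K) :=
  Subgroup.closure {negPair K L, crossedFlip L κ i 0, crossedCyc L ν δ κ i 0,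
    crossedFlip L κ i 1, crossedCyc L ν δ κ i 1}

theorem negPair_mem : negPair K L ∈ crossedGroup L ν δ κ i :=
  Subgroup.subset_closure (by simp)

theorem crossedFlip_mem (j : Fin 2) : crossedFlip L κ i j ∈ crossedGroup L ν δ κ i := by
  refine Subgroup.subset_closure ?_
  revert j
  exact Fin.forall_fin_two.mpr ⟨by simp, by simp⟩

theorem crossedCyc_mem (j : Fin 2) : crossedCyc L ν δ κ i j ∈ crossedGroup L ν δ κ i := by
  refine Subgroup.subset_closure ?_
  revert j
  exact Fin.forall_fin_two.mpr ⟨by simp, by simp⟩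

theorem crossedGroup_normal_form (hi : i * i = -1) (hκ : ∀ j, κ * L j = ν j + 2 * δ j)
    {x : ∀ k, Mono (Fin (L k)) K} (hx : x ∈ crossedGroup L ν δ κ i) :
    ∃ c a₀ b₀ a₁ b₁ : ℤ, x = negPair K L ^ c *
      (crossedFlip L κ i 0 ^ a₀ * crossedCyc L ν δ κ i 0 ^ b₀ *
      (crossedFlip L κ i 1 ^ a₁ * crossedCyc L ν δ κ i 1 ^ b₁)) := by
  have hJ : ∀ j, flip K (L j) * quarter (L j) κ i =
      negMono ^ 1 * (quarter (L j) κ i * flip K (L j)) := fun j => by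
    rw [pow_one]; exact flip_mul_quarter hi
  have hW := fun j => stdCyc_mul_quarter (i := i) hi (hκ j)
  have hWJ : ∀ j, Commute (stdCyc K (L j) (ν j) (δ j)) (flip K (L j)) := fun j => stdCyc_mul_flip
  exact exists_normal_form negPair_mul
    (crossed_commute _ _ (hWJ 0).symm) (crossed_commute _ _ (hWJ 1).symm)
    (crossed_mul hJ hJ) (crossed_mul hJ hW) (crossed_mul hW hJ) (crossed_mul hW hW) hx

theorem crossedFlip_sq (hi : i * i = -1) (j : Fin 2) :
    crossedFlip (K := K) L κ i j ^ (2 : ℤ) = negPair K L := by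
  rw [zpow_ofNat, pow_two]
  funext k
  by_cases hk : k = j
  · subst hk
    rw [Pi.mul_apply, crossedFlip, crossed_same, flip_mul_flip]
  · rw [Pi.mul_apply, crossedFlip, crossed_ne _ _ hk, pow_one, quarter_mul_quarter hi]

theorem crossedCyc_pow (hi : i * i = -1) (hκ : ∀ j, κ * L j = ν j + 2 * δ j) (j : Fin 2) :
    crossedCyc (K := K) L ν δ κ i j ^ L j = negPair K L ^ δ j * crossedFlip L κ i j ^ ν j := by
  funext k
  by_cases hk : k = j
  · subst hk
    simp only [Pi.mul_apply, Pi.pow_apply, crossed_same]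
    exact stdCyc_pow
  · simp only [Pi.mul_apply, Pi.pow_apply, crossed_ne _ _ hk]
    rw [← pow_mul, hκ, pow_add, pow_mul _ 2, pow_two, quarter_mul_quarter hi, pow_one,
      negMono_pow_mul]

theorem crossedGroup_fixed {f : K ≃+* K} (hi : i * i = -1)
    (hf : Units.map (f : K →* K) i = (-1) ^ κ * i) (hκ : ∀ j, κ * L j = ν j + 2 * δ j)
    {x : ∀ k, Mono (Fin (L k)) K} (hx : x ∈ crossedGroup L ν δ κ i) (j : Fin 2) :
    frobMono f (x j) * stdCyc K (L j) (ν j) (δ j) = stdCyc K (L j) (ν j) (δ j) * x j := by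
  have hq : ∀ (k : Fin 2) (e : ℕ), frobMono f (quarter (L k) κ i ^ e) *
      stdCyc K (L k) (ν k) (δ k) = stdCyc K (L k) (ν k) (δ k) * quarter (L k) κ i ^ e := by
    intro k e
    rw [mul_quarter_pow (stdCyc_mul_quarter hi (hκ k)), map_pow, frobMono_quarter hf,
      (Commute.pow_left (negMono_mul _) κ).mul_pow, ← pow_mul, mul_assoc]
  have hcr : ∀ (b : ∀ k, Mono (Fin (L k)) K) (e : ℕ) (k : Fin 2),
      (∀ k, frobMono f (b k) = b k) →
      (∀ k, stdCyc K (L k) (ν k) (δ k) * b k = b k * stdCyc K (L k) (ν k) (δ k)) →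
      frobMono f (crossed κ i b e k j) * stdCyc K (L j) (ν j) (δ j) =
        stdCyc K (L j) (ν j) (δ j) * crossed κ i b e k j := by
    intro b e k h1 h2
    by_cases hk : j = k
    · subst hk
      rw [crossed_same, h1, h2]
    · rw [crossed_ne _ _ hk, hq]
  induction hx using Subgroup.closure_induction with
  | mem x hx =>
    rcases hx with rfl | rfl | rfl | rfl | rfl
    · rw [frobMono_negMono, negMono_mul]
    · exact hcr _ _ _ (fun _ => frobMono_flip f) (fun _ => stdCyc_mul_flip)
    · exact hcr _ _ _ (fun _ => frobMono_stdCyc f) (fun _ => rfl)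
    · exact hcr _ _ _ (fun _ => frobMono_flip f) (fun _ => stdCyc_mul_flip)
    · exact hcr _ _ _ (fun _ => frobMono_stdCyc f) (fun _ => rfl)
  | one => simp
  | mul x y _ _ hx hy => rw [Pi.mul_apply, map_mul, mul_assoc, hy, ← mul_assoc, hx, mul_assoc]
  | inv x _ hx => rw [Pi.inv_apply, map_inv, inv_mul_eq_iff_eq_mul, ← mul_assoc, hx,
      mul_inv_cancel_right]

theorem signedPerm_crossed_ne (b : ∀ j, Mono (Fin (L j)) K) (e : ℕ) {j k : Fin 2} (h : k ≠ j) :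
    signedPerm (crossed κ i b e j k) = 1 := by
  rw [crossed_ne _ _ h, map_pow, signedPerm_quarter, one_pow]

theorem signedPerm_normal_form (a b : Fin 2 → ℤ) (j : Fin 2) :
    signedPerm ((crossedFlip L κ i 0 ^ a 0 * crossedCyc L ν δ κ i 0 ^ b 0 *
      (crossedFlip L κ i 1 ^ a 1 * crossedCyc L ν δ κ i 1 ^ b 1)) j) =
      (Wreath.base fun _ => -1) ^ a j * cyc (L j) ((-1) ^ ν j) ^ b j := by
  simp only [Pi.mul_apply, Pi.pow_apply, map_mul, map_zpow]
  revert j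
  refine Fin.forall_fin_two.mpr ⟨?_, ?_⟩
  · simp only [signedPerm_crossed_ne _ _ (show (0 : Fin 2) ≠ 1 by decide), crossed_same,
      signedPerm_flip, signedPerm_stdCyc, one_zpow, mul_one]
  · simp only [signedPerm_crossed_ne _ _ (show (1 : Fin 2) ≠ 0 by decide), crossed_same,
      signedPerm_flip, signedPerm_stdCyc, one_zpow, one_mul]

/-- If a product of powers of the two generators for a cycle acts trivially on this cycle, then
the corresponding product of their representatives is a power of `-1`. -/
theorem crossed_eq_negPair_zpow (hi : i * i = -1) (hκ : ∀ j, κ * L j = ν j + 2 * δ j)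
    (hL : ∀ j, 0 < L j) (j : Fin 2) {a b : ℤ}
    (h : (Wreath.base fun _ => -1) ^ a * cyc (L j) ((-1 : ℤˣ) ^ ν j) ^ b = 1) :
    ∃ c : ℤ, crossedFlip (K := K) L κ i j ^ a * crossedCyc L ν δ κ i j ^ b = negPair K L ^ c := by
  have hperm : ∀ (A : Wreath (Fin (L j)) ℤˣ) (k : ℤ), (A ^ k).perm = A.perm ^ k := by
    intro A k
    cases k with
    | ofNat k => simp
    | negSucc k => simp
  obtain ⟨b', rfl⟩ : (L j : ℤ) ∣ b := by
    refine dvd_of_finRotate_zpow (i := ⟨0, hL j⟩) ?_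
    have := congrArg (fun D : Wreath (Fin (L j)) ℤˣ => D.perm ⟨0, hL j⟩) h
    simpa [hperm] using this
  rw [zpow_mul, zpow_natCast, cyc_pow_self, ← map_zpow, ← map_zpow, ← map_mul] at h
  -- A full turn contributes the sign `(-1) ^ ν`, so the total exponent of the negation is even.
  have h1 : (-1 : ℤˣ) ^ (a + ν j * b') = 1 := by
    rw [zpow_add, zpow_mul, zpow_natCast]
    exact congrArg (fun D : Wreath (Fin (L j)) ℤˣ => D.lab ⟨0, hL j⟩) h
  obtain ⟨r, hr⟩ : Even (a + ν j * b') := by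
    by_contra ho
    rw [(Int.not_even_iff_odd.mp ho).neg_one_zpow] at h1
    exact absurd h1 (by decide)
  refine ⟨δ j * b' + r, ?_⟩
  have hZ : ∀ x, Commute (negPair K L) x := negPair_mul
  rw [zpow_mul, zpow_natCast, crossedCyc_pow hi hκ,
    (((hZ _).pow_left (δ j)).pow_right (ν j)).mul_zpow, ← zpow_natCast, ← zpow_natCast,
    ← zpow_mul, ← zpow_mul, ← mul_assoc, ← (((hZ _).zpow_left _).zpow_right _).eq, mul_assoc,
    ← zpow_add, hr, ← two_mul, zpow_mul _ 2, crossedFlip_sq hi, ← zpow_add]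

/-- The generated group meets the torus only in `±1`. -/
theorem crossedGroup_inter_torus (hi : i * i = -1) (hκ : ∀ j, κ * L j = ν j + 2 * δ j)
    (hL : ∀ j, 0 < L j) {x : ∀ k, Mono (Fin (L k)) K} (hx : x ∈ crossedGroup L ν δ κ i)
    (h : ∀ j, signedPerm (x j) = 1) : x = 1 ∨ x = negPair K L := by
  obtain ⟨c, a₀, b₀, a₁, b₁, rfl⟩ := crossedGroup_normal_form hi hκ hx
  have hs : ∀ j, (Wreath.base fun _ => -1) ^ (![a₀, a₁] j) *
      cyc (L j) ((-1 : ℤˣ) ^ ν j) ^ (![b₀, b₁] j) = 1 := by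
    intro j
    rw [← signedPerm_normal_form (K := K) (κ := κ) (i := i) (δ := δ), ← h j,
      Pi.mul_apply (negPair K L ^ c), map_mul signedPerm ((negPair K L ^ c) j),
      Pi.pow_apply (negPair K L), map_zpow, signedPerm_negMono, one_zpow, one_mul]
    rfl
  obtain ⟨c₀, h₀⟩ := crossed_eq_negPair_zpow (K := K) hi hκ hL 0 (hs 0)
  obtain ⟨c₁, h₁⟩ := crossed_eq_negPair_zpow (K := K) hi hκ hL 1 (hs 1)
  simp only [Matrix.cons_val_zero, Matrix.cons_val_one] at h₀ h₁
  rw [h₀, h₁, ← zpow_add, ← zpow_add]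
  have h2 : negPair K L ^ (2 : ℤ) = 1 := by
    rw [zpow_ofNat, pow_two]
    exact funext fun _ => negMono_mul_negMono
  rcases Int.even_or_odd' (c + (c₀ + c₁)) with ⟨d, hd | hd⟩
  · left; rw [hd, zpow_mul, h2, one_zpow]
  · right; rw [hd, zpow_add, zpow_mul, h2, one_zpow, one_mul, zpow_one]

theorem crossedGroup_covers (hL : ∀ j, 0 < L j) (r : ∀ j, Fin (L j)) (ε : Fin 2 → ℤˣ) :
    ∃ x ∈ crossedGroup (K := K) L ν δ κ i, ∀ j, (x j).perm ⟨0, hL j⟩ = r j ∧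
      sgn ((x j).lab ⟨0, hL j⟩) = ε j := by
  have : ∀ j, ∃ a : ℤ, (-1 : ℤˣ) ^ a = ε j := fun j => by
    rcases Int.units_eq_one_or (ε j) with h | h
    · exact ⟨0, by simp [h]⟩
    · exact ⟨1, by simp [h]⟩
  choose a ha using this
  refine ⟨_, mul_mem (mul_mem (zpow_mem (crossedFlip_mem 0) (a 0))
    (zpow_mem (crossedCyc_mem 0) ((r 0 : ℕ) : ℤ))) (mul_mem (zpow_mem (crossedFlip_mem 1) (a 1))
    (zpow_mem (crossedCyc_mem 1) ((r 1 : ℕ) : ℤ))), fun j => ?_⟩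
  have h := signedPerm_normal_form (K := K) (κ := κ) (i := i) (δ := δ) (ν := ν) (L := L) a
    (fun j => ((r j : ℕ) : ℤ)) j
  rw [← signedPerm_perm, ← signedPerm_lab, h, zpow_natCast, ← map_zpow]
  constructor
  · rw [Wreath.mul_perm, Equiv.Perm.mul_apply, Wreath.pow_perm, cyc_perm, finRotate_pow_zero,
      Wreath.base_perm, Equiv.Perm.one_apply]
  · rw [Wreath.mul_lab, cyc_pow_lab _ (r j).2.le, if_neg (by simp), mul_one, Wreath.base_lab]
    exact ha j

/-- Every element of the centralizer that preserves the two cycles has a representative. -/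
theorem crossedGroup_surjective (hL : ∀ j, 0 < L j) {f : K ≃+* K} (hi : i * i = -1)
    (hf : Units.map (f : K →* K) i = (-1) ^ κ * i) (hκ : ∀ j, κ * L j = ν j + 2 * δ j)
    {ψ : Wreath (Σ j, Fin (L j)) ℤˣ}
    (hψ : ψ * Wreath.glue (fun j => cyc (L j) ((-1) ^ ν j)) =
      Wreath.glue (fun j => cyc (L j) ((-1) ^ ν j)) * ψ)
    (hb : ∀ j, (ψ.perm ⟨j, 0, hL j⟩).1 = j) :
    ∃ x ∈ crossedGroup (K := K) L ν δ κ i, signedPerm (Wreath.glue x) = ψ := by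
  have : ∀ j, ∃ r, ψ.perm ⟨j, 0, hL j⟩ = ⟨j, r⟩ := fun j => by
    have := hb j
    generalize ψ.perm ⟨j, 0, hL j⟩ = y at this
    obtain ⟨j', r⟩ := y
    obtain rfl : j' = j := this
    exact ⟨r, rfl⟩
  choose r hr using this
  obtain ⟨x, hx, h⟩ := crossedGroup_covers (K := K) (ν := ν) (δ := δ) (κ := κ) (i := i) hL r
    (fun j => ψ.lab ⟨j, 0, hL j⟩)
  refine ⟨x, hx, eq_of_commute_glue_cyc hL ?_ hψ (fun j => ?_) (fun j => (h j).2)⟩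
  · refine signedPerm_commute (f := f) (δ := δ) ?_
    have : frobMono f (Wreath.glue x) = Wreath.glue fun j => frobMono f (x j) := rfl
    rw [this, stdMono, ← map_mul, ← map_mul]
    exact congrArg _ (funext fun j => crossedGroup_fixed hi hf hκ hx j)
  · rw [hr, signedPerm_perm, Wreath.glue_perm, (h j).1]

theorem crossedGroup_swap {n ν δ : ℕ} {x : ∀ _ : Fin 2, Mono (Fin n) K}
    (hx : x ∈ crossedGroup (fun _ => n) (fun _ => ν) (fun _ => δ) κ i) :
    (fun j => x (Equiv.swap 0 1 j)) ∈
      crossedGroup (fun _ => n) (fun _ => ν) (fun _ => δ) κ i := by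
  have hcr : ∀ (b : Mono (Fin n) K) (e : ℕ) (j : Fin 2),
      (fun k => crossed (L := fun _ => n) κ i (fun _ => b) e j (Equiv.swap 0 1 k)) =
      crossed (L := fun _ => n) κ i (fun _ => b) e (Equiv.swap 0 1 j) := by
    intro b e j
    funext k
    by_cases hk : Equiv.swap 0 1 k = j
    · rw [hk, crossed_same, ← hk, Equiv.swap_apply_self, crossed_same]
    · rw [crossed_ne _ _ hk, crossed_ne _ _ (fun h => hk (by rw [h, Equiv.swap_apply_self]))]
  induction hx using Subgroup.closure_induction with
  | mem x hx =>
    rcases hx with rfl | rfl | rfl | rfl | rfl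
    · exact negPair_mem
    · rw [crossedFlip, hcr]; exact crossedFlip_mem _
    · rw [crossedCyc, hcr]; exact crossedCyc_mem _
    · rw [crossedFlip, hcr]; exact crossedFlip_mem _
    · rw [crossedCyc, hcr]; exact crossedCyc_mem _
  | one => exact one_mem _
  | mul x y _ _ hx hy => exact mul_mem hx hy
  | inv x _ hx => exact inv_mem hx

/-- The interchange of two cycles of the same type. -/
def interchange (K : Type*) [Field K] (n : ℕ) : Mono (Σ _ : Fin 2, Fin n) K :=
  ⟨⟨fun x => ⟨Equiv.swap 0 1 x.1, x.2⟩, fun x => ⟨Equiv.swap 0 1 x.1, x.2⟩,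
    fun x => by simp, fun x => by simp⟩, fun _ => 1⟩

@[simp] theorem interchange_perm (n : ℕ) (x : Σ _ : Fin 2, Fin n) :
    (interchange K n).perm x = ⟨Equiv.swap 0 1 x.1, x.2⟩ := rfl

@[simp] theorem interchange_lab (n : ℕ) (x : Σ _ : Fin 2, Fin n) :
    (interchange K n).lab x = 1 := rfl

theorem interchange_mul_interchange (n : ℕ) : interchange K n * interchange K n = 1 :=
  Wreath.ext' (fun x => by simp) (fun x => by simp)

theorem interchange_mul_glue {n : ℕ} (x : ∀ _ : Fin 2, Mono (Fin n) K) :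
    interchange K n * Wreath.glue x =
      Wreath.glue (fun j => x (Equiv.swap 0 1 j)) * interchange K n :=
  Wreath.ext' (fun x => by simp) (fun x => by simp)

theorem frobMono_interchange (f : K ≃+* K) (n : ℕ) :
    frobMono f (interchange K n) = interchange K n :=
  Wreath.ext' (fun x => by simp) (fun x => by simp)

/-- An element of the centralizer of two cycles preserves or interchanges them. -/
theorem block_eq_or_eq_swap (hL : ∀ j, 0 < L j) {ψ : Wreath (Σ j, Fin (L j)) ℤˣ}
    (hψ : ψ * Wreath.glue (fun j => cyc (L j) ((-1) ^ ν j)) =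
      Wreath.glue (fun j => cyc (L j) ((-1) ^ ν j)) * ψ) :
    (∀ j, (ψ.perm ⟨j, 0, hL j⟩).1 = j) ∨
      (∀ j, (ψ.perm ⟨j, 0, hL j⟩).1 = Equiv.swap 0 1 j) := by
  have key : ∀ β : Fin 2 → Fin 2, Function.Injective β →
      (∀ j, β j = j) ∨ (∀ j, β j = Equiv.swap 0 1 j) := by decide
  refine key (fun j => (ψ.perm ⟨j, 0, hL j⟩).1) fun j j' h => ?_
  have h1 := block_inv_of_commute_glue_cyc hL hψ j
  have h2 := block_inv_of_commute_glue_cyc hL hψ j'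
  simp only at h
  rw [← h1, ← h2, h]

/-- For two cycles of different types that satisfy the parity condition the generated group is a
complement modulo `±1`: no symmetry interchanges the cycles, so each cycle is preserved. -/
theorem splits_of_different (hL : ∀ j, 0 < L j) {f : K ≃+* K} (hi : i * i = -1)
    (hf : Units.map (f : K →* K) i = (-1) ^ κ * i) (hκ : ∀ j, κ * L j = ν j + 2 * δ j)
    (hne : ¬ (L 0 = L 1 ∧ (-1 : ℤˣ) ^ ν 0 = (-1) ^ ν 1)) : Splits f (stdMono K L ν δ) := by
  refine ⟨(crossedGroup L ν δ κ i).map Wreath.glue, ?_, ?_, ⟨_, negPair_mem, rfl⟩, fun y hy => ?_⟩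
  · rintro _ ⟨x, hx, rfl⟩
    have : frobMono f (Wreath.glue x) = Wreath.glue fun j => frobMono f (x j) := rfl
    rw [this, stdMono, ← map_mul, ← map_mul]
    exact congrArg _ (funext fun j => crossedGroup_fixed hi hf hκ hx j)
  · rintro _ ⟨x, hx, rfl⟩ hs
    have hs' : ∀ j, signedPerm (x j) = 1 := congrFun (Wreath.glue_injective
      ((show Wreath.glue (fun j => signedPerm (x j)) = 1 from hs).trans (map_one _).symm))
    rcases crossedGroup_inter_torus hi hκ hL hx hs' with rfl | rfl
    · exact Or.inl (map_one _)
    · exact Or.inr rfl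
  · have hψ := signedPerm_commute hy
    rcases block_eq_or_eq_swap hL hψ with hb | hb
    · obtain ⟨x, hx, h⟩ := crossedGroup_surjective (K := K) hL hi hf hκ hψ hb
      exact ⟨_, ⟨x, hx, rfl⟩, h⟩
    · have h1 := length_of_commute_glue_cyc hL hψ 0
      have h2 := sign_of_commute_glue_cyc hL hψ 0
      rw [hb] at h1 h2
      exact absurd ⟨h1.symm, h2.symm⟩ hne

/-- For two cycles of the same type the interchange of the cycles has to be adjoined. -/
theorem splits_of_same {n ν δ : ℕ} (hn : 0 < n) {f : K ≃+* K} (hi : i * i = -1)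
    (hf : Units.map (f : K →* K) i = (-1) ^ κ * i) (hκ : κ * n = ν + 2 * δ) :
    Splits f (stdMono K (fun _ : Fin 2 => n) (fun _ => ν) (fun _ => δ)) := by
  set P := interchange K n
  have hPP : P * P = 1 := interchange_mul_interchange n
  have hPw : P * stdMono K (fun _ : Fin 2 => n) (fun _ => ν) (fun _ => δ) =
      stdMono K (fun _ : Fin 2 => n) (fun _ => ν) (fun _ => δ) * P :=
    interchange_mul_glue _
  set H := (crossedGroup (fun _ => n) (fun _ => ν) (fun _ => δ) κ i).map
    (Wreath.glue (M := MonoSL2 K)) with hHdef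
  obtain ⟨H', hH'⟩ := exists_subgroup_adjoin_involution H hPP (by
    rintro _ ⟨x, hx, rfl⟩
    rw [interchange_mul_glue, mul_assoc, hPP, mul_one]
    exact ⟨_, crossedGroup_swap hx, rfl⟩)
  have hfix : ∀ h ∈ H, frobMono f h * stdMono K (fun _ : Fin 2 => n) (fun _ => ν) (fun _ => δ) =
      stdMono K (fun _ : Fin 2 => n) (fun _ => ν) (fun _ => δ) * h := by
    rintro _ ⟨x, hx, rfl⟩
    have : frobMono f (Wreath.glue x) = Wreath.glue fun j => frobMono f (x j) := rfl
    rw [this, stdMono, ← map_mul, ← map_mul]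
    exact congrArg _ (funext fun j => crossedGroup_fixed hi hf (fun _ => hκ) hx j)
  have hmul : ∀ y, P * (P * y) = y := fun y => by rw [← mul_assoc, hPP, one_mul]
  have hPfix : ∀ y, frobMono f y * stdMono K (fun _ : Fin 2 => n) (fun _ => ν) (fun _ => δ) =
      stdMono K (fun _ : Fin 2 => n) (fun _ => ν) (fun _ => δ) * y →
      frobMono f (P * y) * stdMono K (fun _ : Fin 2 => n) (fun _ => ν) (fun _ => δ) =
      stdMono K (fun _ : Fin 2 => n) (fun _ => ν) (fun _ => δ) * (P * y) := fun y hy => by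
    rw [map_mul, show frobMono f P = P from frobMono_interchange f n, mul_assoc, hy, ← mul_assoc,
      hPw, mul_assoc]
  refine ⟨H', fun h hh => ?_, fun h hh hs => ?_, (hH' _).mpr (Or.inl ⟨_, negPair_mem, rfl⟩),
    fun y hy => ?_⟩
  · rcases (hH' h).mp hh with hh | hh
    · exact hfix h hh
    · rw [← hmul h]
      exact hPfix _ (hfix _ hh)
  · rcases (hH' h).mp hh with ⟨x, hx, rfl⟩ | ⟨x, hx, hx'⟩
    · have hs' : ∀ j, signedPerm (x j) = 1 := congrFun (Wreath.glue_injective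
        ((show Wreath.glue (fun j => signedPerm (x j)) = 1 from hs).trans (map_one _).symm))
      rcases crossedGroup_inter_torus hi (fun _ => hκ) (fun _ => hn) hx hs' with rfl | rfl
      · exact Or.inl (map_one _)
      · exact Or.inr rfl
    · exfalso
      have hp : h.perm = 1 := by rw [← signedPerm_perm, hs]; rfl
      have := congrArg (fun D : Mono (Σ _ : Fin 2, Fin n) K => (D.perm ⟨0, 0, hn⟩).1) hx'
      rw [Wreath.mul_perm, hp] at this
      exact absurd (show (0 : Fin 2) = 1 from this) (by decide)
  · have hψ := signedPerm_commute hy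
    rcases block_eq_or_eq_swap (L := fun _ => n) (fun _ => hn) hψ with hb | hb
    · obtain ⟨x, hx, h⟩ := crossedGroup_surjective (K := K) (δ := fun _ => δ) (fun _ => hn) hi hf
        (fun _ => hκ) hψ hb
      exact ⟨_, (hH' _).mpr (Or.inl ⟨x, hx, rfl⟩), h⟩
    · obtain ⟨x, hx, h⟩ := crossedGroup_surjective (K := K) (δ := fun _ => δ) (fun _ => hn) hi hf
        (fun _ => hκ) (signedPerm_commute (hPfix y hy)) (fun j => by
          have h1 : ((signedPerm (P * y)).perm ⟨j, 0, hn⟩).1 =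
            Equiv.swap 0 1 ((signedPerm y).perm ⟨j, 0, hn⟩).1 := rfl
          exact h1.trans (by rw [hb j, Equiv.swap_apply_self]))
      refine ⟨P * Wreath.glue x, (hH' _).mpr (Or.inr ?_), ?_⟩
      · rw [hmul]
        exact ⟨x, hx, rfl⟩
      · rw [map_mul, h, ← map_mul, hmul]

/-- Sufficiency of the parity condition for two cycles. -/
theorem splits_of_fin_two (hL : ∀ j, 0 < L j) (hν : ∀ j, ν j ≤ 1) {f : K ≃+* K}
    (hi : i * i = -1) (hf : Units.map (f : K →* K) i = (-1) ^ κ * i)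
    (hκ : ∀ j, κ * L j = ν j + 2 * δ j) : Splits f (stdMono K L ν δ) := by
  by_cases h : L 0 = L 1 ∧ (-1 : ℤˣ) ^ ν 0 = (-1) ^ ν 1
  · obtain ⟨h1, h2⟩ := h
    have h3 : ν 1 = ν 0 := by
      have := hν 0; have := hν 1
      rcases Nat.le_one_iff_eq_zero_or_eq_one.mp (hν 0) with h0 | h0 <;>
      rcases Nat.le_one_iff_eq_zero_or_eq_one.mp (hν 1) with h1 | h1 <;>
        rw [h0, h1] at h2 ⊢ <;> exact absurd h2 (by decide)
    have h4 : δ 1 = δ 0 := by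
      have e0 := hκ 0; have e1 := hκ 1
      rw [← h1] at e1
      omega
    obtain ⟨n, rfl⟩ : ∃ n, L = fun _ => n :=
      ⟨L 0, funext (Fin.forall_fin_two.mpr ⟨rfl, h1.symm⟩)⟩
    obtain ⟨ν', rfl⟩ : ∃ n, ν = fun _ => n := ⟨ν 0, funext (Fin.forall_fin_two.mpr ⟨rfl, h3⟩)⟩
    obtain ⟨δ', rfl⟩ : ∃ n, δ = fun _ => n := ⟨δ 0, funext (Fin.forall_fin_two.mpr ⟨rfl, h4⟩)⟩
    exact splits_of_same (hL 0) hi hf (hκ 0)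
  · exact splits_of_different hL hi hf hκ h

end pair
end SympTorus

namespace SympTorus
open MonoSL2

/-! ### Monomial symplectic matrices as matrices -/

section toSp

variable {K : Type*} [Field K] {n : ℕ}

/-- The matrix entries of a monomial element of `SL₂(K)`; the index `true` stands for the first
basis vector. -/
def MonoSL2.entry : MonoSL2 K → Bool → Bool → K
  | diag a, true, true => a
  | diag a, false, false => ((a⁻¹ : Kˣ) : K)
  | anti a, false, true => a
  | anti a, true, false => -((a⁻¹ : Kˣ) : K)
  | diag _, true, false => 0
  | diag _, false, true => 0
  | anti _, true, true => 0
  | anti _, false, false => 0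

theorem entry_mul (x y : MonoSL2 K) (s t : Bool) :
    x.entry s true * y.entry true t + x.entry s false * y.entry false t = (x * y).entry s t := by
  rcases x with a | a <;> rcases y with b | b <;> cases s <;> cases t <;>
    simp [entry, mul_comm]

theorem entry_frob (f : K ≃+* K) (x : MonoSL2 K) (s t : Bool) :
    (frob f x).entry s t = f (x.entry s t) := by
  rcases x with a | a <;> cases s <;> cases t <;> simp [entry]

theorem entry_transpose (x : MonoSL2 K) (s t : Bool) :
    (anti 1 * x⁻¹ * (anti 1)⁻¹).entry s t = x.entry t s := by
  rcases x with a | a <;> cases s <;> cases t <;> simp [entry]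

/-- The matrix of an element of the monomial group. -/
def toMat (A : Mono (Fin n) K) : Matrix (Fin n ⊕ Fin n) (Fin n ⊕ Fin n) K :=
  fun x y => if absIdx x = A.perm (absIdx y) then (A.lab (absIdx y)).entry x.isLeft y.isLeft else 0

theorem toMat_of_eq (A : Mono (Fin n) K) {x y : Fin n ⊕ Fin n}
    (h : absIdx x = A.perm (absIdx y)) :
    toMat A x y = (A.lab (absIdx y)).entry x.isLeft y.isLeft := if_pos h

theorem toMat_of_ne (A : Mono (Fin n) K) {x y : Fin n ⊕ Fin n}
    (h : absIdx x ≠ A.perm (absIdx y)) : toMat A x y = 0 := if_neg h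

theorem toMat_mul (A B : Mono (Fin n) K) : toMat (A * B) = toMat A * toMat B := by
  ext x y
  rw [Matrix.mul_apply, Fintype.sum_sum_type, Finset.sum_eq_single (B.perm (absIdx y)),
    Finset.sum_eq_single (B.perm (absIdx y))]
  · rw [toMat_of_eq B (x := Sum.inl _) rfl, toMat_of_eq B (x := Sum.inr _) rfl]
    by_cases h : absIdx x = A.perm (B.perm (absIdx y))
    · rw [toMat_of_eq A (y := Sum.inl _) h, toMat_of_eq A (y := Sum.inr _) h,
        toMat_of_eq (A * B) h]
      exact (entry_mul _ _ _ _).symm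
    · rw [toMat_of_ne A (y := Sum.inl _) h, toMat_of_ne A (y := Sum.inr _) h,
        toMat_of_ne (A * B) h, zero_mul, zero_mul, add_zero]
  · intro j _ hj
    rw [toMat_of_ne B (x := Sum.inr j) hj, mul_zero]
  · simp
  · intro j _ hj
    rw [toMat_of_ne B (x := Sum.inl j) hj, mul_zero]
  · simp

theorem toMat_one : toMat (1 : Mono (Fin n) K) = 1 := by
  ext x y
  by_cases h : absIdx x = absIdx y
  · rw [toMat_of_eq _ h]
    rcases x with i | i <;> rcases y with j | j <;> obtain rfl : i = j := h <;>
      simp [one_def, entry]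
  · rw [toMat_of_ne _ h, Matrix.one_apply_ne (fun h' => h (by rw [h']))]

theorem toMat_transpose (A : Mono (Fin n) K) : (toMat A).transpose =
    toMat (Wreath.base (fun _ => anti 1) * A⁻¹ * (Wreath.base (fun _ => anti 1))⁻¹) := by
  ext x y
  rw [Matrix.transpose_apply]
  by_cases h : absIdx y = A.perm (absIdx x)
  · have h' : A.perm⁻¹ (absIdx y) = absIdx x := by rw [h]; simp
    rw [toMat_of_eq _ h, toMat_of_eq]
    · simp only [Wreath.inv_perm, Wreath.base_perm, inv_one, Wreath.mul_lab, Wreath.base_lab,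
        Wreath.inv_lab, Equiv.Perm.one_apply, h', entry_transpose]
    · simpa using h'.symm
  · rw [toMat_of_ne _ h, toMat_of_ne]
    intro h'
    refine h ?_
    have h'' : absIdx x = A.perm⁻¹ (absIdx y) := by simpa using h'
    rw [h'']
    simp

theorem toMat_J : toMat (Wreath.base fun _ : Fin n => (anti 1 : MonoSL2 K)) = Matrix.J (Fin n) K := by
  ext x y
  by_cases h : absIdx x = absIdx y
  · rw [toMat_of_eq _ h]
    rcases x with i | i <;> rcases y with j | j <;> obtain rfl : i = j := h <;>
      simp [Matrix.J, entry]
  · rw [toMat_of_ne _ h]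
    rcases x with i | i <;> rcases y with j | j
    · simp [Matrix.J]
    · simp [Matrix.J, Matrix.one_apply_ne (show i ≠ j from h)]
    · simp [Matrix.J, Matrix.one_apply_ne (show i ≠ j from h)]
    · simp [Matrix.J]

/-- The embedding of the monomial group into the symplectic group. -/
def toSp (n : ℕ) (K : Type*) [Field K] : Mono (Fin n) K →* Sp n K where
  toFun A := ⟨toMat A, by
    rw [SymplecticGroup.mem_iff', ← toMat_J, toMat_transpose, ← toMat_mul, ← toMat_mul]
    congr 1
    group⟩
  map_one' := Subtype.ext toMat_one
  map_mul' A B := Subtype.ext (toMat_mul A B)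

@[simp] theorem coe_toSp (A : Mono (Fin n) K) : (toSp n K A : Matrix _ _ K) = toMat A := rfl

theorem toSp_injective : Function.Injective (toSp n K) := by
  rw [injective_iff_map_eq_one]
  intro A hA
  have h : ∀ j, A.perm j = j ∧ A.lab j = 1 := by
    intro j
    have h1 : toMat A (Sum.inl j) (Sum.inl j) = 1 := by
      rw [← coe_toSp, hA, OneMemClass.coe_one, Matrix.one_apply_eq]
    by_cases h2 : j = A.perm j
    · refine ⟨h2.symm, ?_⟩
      rw [toMat_of_eq A (x := Sum.inl j) (y := Sum.inl j) h2] at h1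
      change (A.lab j).entry true true = 1 at h1
      generalize A.lab j = x at h1
      rcases x with a | a
      · rw [one_def, Units.ext (show (a : K) = (1 : Kˣ) from h1)]
      · exact absurd (show (0 : K) = 1 from h1) zero_ne_one
    · rw [toMat_of_ne A (x := Sum.inl j) (y := Sum.inl j) h2] at h1
      exact absurd h1 zero_ne_one
  exact Wreath.ext' (fun j => (h j).1) (fun j => (h j).2)

theorem spCongr_toSp (f : K ≃+* K) (A : Mono (Fin n) K) :
    spCongr n f (toSp n K A) = toSp n K (frobMono f A) := by
  apply Subtype.ext
  ext x y
  change f (toMat A x y) = toMat (frobMono f A) x y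
  by_cases h : absIdx x = A.perm (absIdx y)
  · rw [toMat_of_eq A h, toMat_of_eq (frobMono f A) h, frobMono_lab, entry_frob]
  · rw [toMat_of_ne A h, toMat_of_ne (frobMono f A) h, map_zero]

theorem diagHom_eq (d : Fin n → Kˣ) : diagHom n K d = toSp n K (Wreath.base fun i => diag (d i)) := by
  apply Subtype.ext
  ext x y
  rw [coe_toSp]
  by_cases h : absIdx x = absIdx y
  · rw [toMat_of_eq _ h]
    rcases x with i | i <;> rcases y with j | j <;> obtain rfl : i = j := h <;>
      simp [diagHom, entry, absIdx]
  · rw [toMat_of_ne _ h]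
    rcases x with i | i <;> rcases y with j | j
    · simp only [diagHom, MonoidHom.coe_mk, OneHom.coe_mk, Matrix.fromBlocks_apply₁₁]
      exact Matrix.diagonal_apply_ne _ h
    · simp [diagHom]
    · simp [diagHom]
    · simp only [diagHom, MonoidHom.coe_mk, OneHom.coe_mk, Matrix.fromBlocks_apply₂₂]
      exact Matrix.diagonal_apply_ne _ h

theorem signedPerm_eq_one_iff {ι : Type*} {A : Mono ι K} :
    signedPerm A = 1 ↔ ∃ d : ι → Kˣ, A = Wreath.base fun i => diag (d i) := by
  constructor
  · intro h
    have h1 : ∀ i, ∃ a, A.lab i = diag a := fun i =>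
      sgn_eq_one (by rw [← signedPerm_lab, h]; rfl)
    choose d hd using h1
    refine ⟨d, Wreath.ext' (fun i => ?_) hd⟩
    rw [← signedPerm_perm, h]
    rfl
  · rintro ⟨d, rfl⟩
    exact Wreath.ext' (fun i => by simp) (fun i => by simp)

theorem J_apply_swap (x : Fin n ⊕ Fin n) : Matrix.J (Fin n) K x x.swap ≠ 0 := by
  rcases x with i | i <;> simp [Matrix.J]

theorem eq_swap_of_J_ne_zero {x y : Fin n ⊕ Fin n} (h : Matrix.J (Fin n) K x y ≠ 0) : y = x.swap := by
  rcases x with i | i <;> rcases y with j | j <;> simp [Matrix.J, Matrix.one_apply] at h ⊢ <;>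
    exact h.symm

/-- A symplectic matrix whose nonzero entries are at the places of a permutation comes from the
monomial group. -/
theorem exists_toSp_eq (A : Sp n K) (φ : Equiv.Perm (Fin n ⊕ Fin n))
    (h : ∀ x y, A.1 x y ≠ 0 ↔ x = φ y) :
    ∃ B : Mono (Fin n) K, toSp n K B = A ∧ (∀ x, absIdx (φ x) = B.perm (absIdx x)) ∧
      ∀ x, (if (φ x).isLeft then (1 : ℤˣ) else -1) =
        sgn (B.lab (absIdx x)) * if x.isLeft then 1 else -1 := by
  have hz : ∀ x y, x ≠ φ y → A.1 x y = 0 := fun x y hxy => by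
    by_contra h0
    exact hxy ((h x y).mp h0)
  have hne : ∀ y, A.1 (φ y) y ≠ 0 := fun y => (h _ _).mpr rfl
  have hJ : ∀ x y, A.1 (φ x) x * Matrix.J (Fin n) K (φ x) (φ y) * A.1 (φ y) y = Matrix.J (Fin n) K x y := by
    intro x y
    have h1 := congrFun (congrFun (SymplecticGroup.mem_iff'.mp A.2) x) y
    rw [← h1, Matrix.mul_apply, Finset.sum_eq_single (φ y)]
    · rw [Matrix.mul_apply, Finset.sum_eq_single (φ x)]
      · rfl
      · intro z _ hzx
        rw [Matrix.transpose_apply, hz _ _ hzx, zero_mul]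
      · simp
    · intro z _ hzy
      rw [hz _ _ hzy, mul_zero]
    · simp
  have hsw : ∀ x, φ x.swap = (φ x).swap := fun x => eq_swap_of_J_ne_zero (K := K) fun h0 =>
    J_apply_swap (K := K) x (by rw [← hJ, h0, mul_zero, zero_mul])
  have habs : ∀ x : Fin n ⊕ Fin n, absIdx x.swap = absIdx x := by rintro (i | i) <;> rfl
  have habs' : ∀ x y : Fin n ⊕ Fin n, absIdx x = absIdx y → x = y ∨ x = y.swap := by
    rintro (i | i) (j | j) hij <;> simp_all [absIdx]
  have hφ : ∀ x, absIdx (φ x) = absIdx (φ (Sum.inl (absIdx x))) := by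
    rintro (i | i)
    · rfl
    · rw [show (Sum.inr i : Fin n ⊕ Fin n) = (Sum.inl i : Fin n ⊕ Fin n).swap from rfl, hsw, habs]
      rfl
  have hinj : Function.Injective fun j : Fin n => absIdx (φ (Sum.inl j)) := by
    intro i j hij
    rcases habs' _ _ hij with h1 | h1
    · exact Sum.inl_injective (φ.injective h1)
    · rw [← hsw] at h1
      exact absurd (φ.injective h1) (by simp)
  let π : Equiv.Perm (Fin n) := Equiv.ofBijective _ (Finite.injective_iff_bijective.mp hinj)
  have hlab : ∀ j, ∃ m : MonoSL2 K, (∀ x y : Fin n ⊕ Fin n, absIdx x = π j → absIdx y = j →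
      m.entry x.isLeft y.isLeft = A.1 x y) ∧ ((φ (Sum.inl j)).isLeft ↔ sgn m = 1) := by
    intro j
    have h1 := hne (Sum.inl j)
    have h2 := hJ (Sum.inl j) (Sum.inr j)
    have h3 : φ (Sum.inr j) = (φ (Sum.inl j)).swap := hsw (Sum.inl j)
    have h4 : absIdx (φ (Sum.inl j)) = π j := rfl
    have h5 := fun x => hz x (Sum.inl j)
    have h6 := fun x => hz x (Sum.inr j)
    rw [h3] at h2 h6
    revert h1 h2 h4 h5 h6
    generalize φ (Sum.inl j) = u
    intro h1 h2 h4 h5 h6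
    rcases u with k | k
    · obtain rfl : k = π j := h4
      refine ⟨diag (Units.mk0 _ h1), ?_, by simp⟩
      have h7 : A.1 (Sum.inr (π j)) (Sum.inr j) = (A.1 (Sum.inl (π j)) (Sum.inl j))⁻¹ := by
        refine eq_inv_of_mul_eq_one_right ?_
        simpa [Matrix.J] using h2
      rintro (x | x) (y | y) hx hy <;> obtain rfl : x = π j := hx <;> obtain rfl : y = j := hy
      · rfl
      · exact (h6 _ (by simp)).symm
      · exact (h5 _ (by simp)).symm
      · simp [entry, h7]
    · obtain rfl : k = π j := h4
      refine ⟨anti (Units.mk0 _ h1), ?_, by simp⟩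
      have h7 : A.1 (Sum.inl (π j)) (Sum.inr j) = -(A.1 (Sum.inr (π j)) (Sum.inl j))⁻¹ := by
        have : A.1 (Sum.inr (π j)) (Sum.inl j) * A.1 (Sum.inl (π j)) (Sum.inr j) = -1 := by
          simpa [Matrix.J] using h2
        rw [← neg_eq_iff_eq_neg]
        exact eq_inv_of_mul_eq_one_right (by rw [mul_neg, this, neg_neg])
      rintro (x | x) (y | y) hx hy <;> obtain rfl : x = π j := hx <;> obtain rfl : y = j := hy
      · exact (h5 _ (by simp)).symm
      · simp [entry, h7]
      · rfl
      · exact (h6 _ (by simp)).symm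
  choose m hm hs using hlab
  refine ⟨⟨π, m⟩, ?_, hφ, ?_⟩
  · apply Subtype.ext
    ext x y
    rw [coe_toSp]
    by_cases hxy : absIdx x = π (absIdx y)
    · rw [toMat_of_eq _ hxy]
      exact hm _ x y hxy rfl
    · rw [toMat_of_ne _ hxy]
      refine (hz x y ?_).symm
      rintro rfl
      exact hxy (hφ y)
  · have key : ∀ j, (if (φ (Sum.inl j)).isLeft then (1 : ℤˣ) else -1) = sgn (m j) := by
      intro j
      rcases Int.units_eq_one_or (sgn (m j)) with h1 | h1
      · rw [if_pos ((hs j).mpr h1), h1]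
      · rw [if_neg (fun h2 => absurd ((hs j).mp h2) (by rw [h1]; decide)), h1]
    rintro (j | j)
    · rw [if_pos (show (Sum.inl j : Fin n ⊕ Fin n).isLeft from rfl), mul_one]
      exact key j
    · have h1 := key j
      rw [show (Sum.inr j : Fin n ⊕ Fin n) = (Sum.inl j : Fin n ⊕ Fin n).swap from rfl, hsw]
      change _ = sgn (m j) * _
      rw [← h1]
      rcases φ (Sum.inl j) with k | k <;> simp

end toSp
end SympTorus

namespace SympTorus
open MonoSL2

/-! ### The center and the normalizer of the diagonal torus -/

section normalizer

variable {K : Type*} [Field K] {n : ℕ}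

theorem exists_unit_sq_ne_one (K : Type*) [Field K] [Infinite K] : ∃ a : Kˣ, a * a ≠ 1 := by
  classical
  obtain ⟨x, hx⟩ := Infinite.exists_notMem_finset ({0, 1, -1} : Finset K)
  simp only [Finset.mem_insert, Finset.mem_singleton, not_or] at hx
  refine ⟨Units.mk0 x hx.1, fun h => ?_⟩
  have h1 : x * x = 1 := congrArg Units.val h
  rcases mul_self_eq_one_iff.mp h1 with h2 | h2
  · exact hx.2.1 h2
  · exact hx.2.2 h2

theorem coe_diagHom (d : Fin n → Kˣ) : (diagHom n K d).1 =
    Matrix.diagonal (Sum.elim (fun i => ((d i : Kˣ) : K)) fun i => (((d i)⁻¹ : Kˣ) : K)) :=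
  Matrix.fromBlocks_diagonal _ _

/-- A symplectic matrix that conjugates all diagonal matrices of the torus to diagonal matrices is
monomial, since the torus separates the coordinates. -/
theorem mem_range_toSp [Infinite K] (A : Sp n K)
    (h : ∀ d : Fin n → Kˣ, ∃ t : Fin n ⊕ Fin n → K,
      A.1 * (diagHom n K d).1 = Matrix.diagonal t * A.1) : ∃ B, toSp n K B = A := by
  obtain ⟨a, ha⟩ := exists_unit_sq_ne_one K
  have ha1 : a ≠ 1 := fun h => ha (by rw [h, one_mul])
  have huniq : ∀ x y y', A.1 x y ≠ 0 → A.1 x y' ≠ 0 → y = y' := by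
    intro x y y' h1 h2
    obtain ⟨t, ht⟩ := h fun i => if i = absIdx y then a else 1
    rw [coe_diagHom] at ht
    have key : ∀ z, A.1 x z ≠ 0 → Sum.elim (fun i => (((if i = absIdx y then a else 1 : Kˣ)) : K))
        (fun i => (((if i = absIdx y then a else 1 : Kˣ)⁻¹ : Kˣ) : K)) z = t x := by
      intro z hz
      have := congrFun (congrFun ht x) z
      rw [Matrix.mul_diagonal, Matrix.diagonal_mul, mul_comm] at this
      exact mul_right_cancel₀ hz this
    have h3 := (key y h1).trans (key y' h2).symm
    rcases y with i | i <;> rcases y' with j | j <;>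
      simp only [absIdx, Sum.elim_inl, Sum.elim_inr, id, if_true] at h3 <;>
      by_cases hj : j = i <;>
      simp only [hj, if_true, if_false, Units.val_inj] at h3 ⊢
    · exact absurd h3 ha1
    · exact absurd (mul_eq_one_iff_eq_inv.mpr h3) ha
    · exact absurd (h3.trans inv_one) ha1
    · exact absurd (mul_eq_one_iff_eq_inv.mpr h3.symm) ha
    · exact absurd (inv_eq_one.mp h3) ha1
    · exact absurd (inv_injective h3) ha1
  have hrow : ∀ x, ∃ y, A.1 x y ≠ 0 := by
    intro x
    by_contra! h0
    have h1 : A.1 * (A⁻¹).1 = 1 := congrArg Subtype.val (mul_inv_cancel A)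
    have h2 := congrFun (congrFun h1 x) x
    rw [Matrix.mul_apply, Finset.sum_eq_zero (fun y _ => by rw [h0, zero_mul]),
      Matrix.one_apply_eq] at h2
    exact zero_ne_one h2
  have hcol : ∀ y, ∃ x, A.1 x y ≠ 0 := by
    intro y
    by_contra! h0
    have h1 : (A⁻¹).1 * A.1 = 1 := congrArg Subtype.val (inv_mul_cancel A)
    have h2 := congrFun (congrFun h1 y) y
    rw [Matrix.mul_apply, Finset.sum_eq_zero (fun x _ => by rw [h0, mul_zero]),
      Matrix.one_apply_eq] at h2
    exact zero_ne_one h2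
  choose ρ hρ using hrow
  have hsurj : Function.Surjective ρ := fun y => by
    obtain ⟨x, hx⟩ := hcol y
    exact ⟨x, huniq x _ _ (hρ x) hx⟩
  let e := Equiv.ofBijective ρ (Finite.surjective_iff_bijective.mp hsurj)
  obtain ⟨B, hB, -⟩ := exists_toSp_eq A e.symm (fun x y => by
    rw [Equiv.eq_symm_apply]
    constructor
    · exact fun h1 => huniq x _ _ (hρ x) h1
    · rintro rfl
      exact hρ x)
  exact ⟨B, hB⟩

theorem toSp_negMono_mem_center : toSp n K negMono ∈ Subgroup.center (Sp n K) := by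
  have h1 : (toSp n K negMono).1 = -1 := by
    ext x y
    rw [coe_toSp, Matrix.neg_apply]
    by_cases h : absIdx x = absIdx y
    · rw [toMat_of_eq _ h]
      rcases x with i | i <;> rcases y with j | j <;> obtain rfl : i = j := h <;>
        simp [negOne, entry]
    · rw [toMat_of_ne _ h, Matrix.one_apply_ne (fun h' => h (by rw [h'])), neg_zero]
  rw [Subgroup.mem_center_iff]
  intro A
  apply Subtype.ext
  change A.1 * (toSp n K negMono).1 = (toSp n K negMono).1 * A.1
  rw [h1, mul_neg, neg_mul, mul_one, one_mul]

/-- The center of the symplectic group consists of `± 1`. -/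
theorem mem_center_iff [Infinite K] (hn : 0 < n) (A : Sp n K) :
    A ∈ Subgroup.center (Sp n K) ↔ A = 1 ∨ A = toSp n K negMono := by
  constructor
  · intro hA
    rw [Subgroup.mem_center_iff] at hA
    obtain ⟨y, rfl⟩ := mem_range_toSp A fun d =>
      ⟨_, (congrArg Subtype.val (hA (diagHom n K d)).symm).trans
        (congrArg (· * A.1) (coe_diagHom d))⟩
    have hy : ∀ B : Mono (Fin n) K, B * y = y * B := fun B =>
      toSp_injective (by rw [map_mul, map_mul, hA])
    obtain ⟨a, ha⟩ := exists_unit_sq_ne_one K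
    have ha1 : a ≠ 1 := fun h => ha (by rw [h, one_mul])
    have h1 : ∀ i, y.perm i = i ∧ ∃ c, y.lab i = diag c := by
      intro i
      have h2 := congrArg (fun D : Mono (Fin n) K => D.lab i)
        (hy (Wreath.base fun j => if j = i then diag a else 1))
      simp only [Wreath.mul_lab, Wreath.base_lab, Wreath.base_perm, Equiv.Perm.one_apply,
        if_true] at h2
      generalize y.lab i = m at h2
      by_cases h3 : y.perm i = i
      · rw [if_pos h3] at h2
        refine ⟨h3, ?_⟩
        rcases m with c | c
        · exact ⟨c, rfl⟩
        · simp only [diag_mul_anti, anti_mul_diag, anti.injEq] at h2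
          rw [mul_comm c, mul_left_inj] at h2
          exact absurd (mul_eq_one_iff_eq_inv.mpr h2.symm) ha
      · rw [if_neg h3, one_mul, left_eq_mul, one_def, diag.injEq] at h2
        exact absurd h2 ha1
    have h2 : ∀ i, y.lab i = 1 ∨ y.lab i = negOne := by
      intro i
      obtain ⟨h3, c, hc⟩ := h1 i
      have h4 := congrArg (fun D : Mono (Fin n) K => D.lab i) (hy (Wreath.base fun _ => anti 1))
      simp only [Wreath.mul_lab, Wreath.base_lab, Wreath.base_perm, Equiv.Perm.one_apply, hc,
        anti_mul_diag, diag_mul_anti, anti.injEq, one_mul, mul_one] at h4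
      have h5 : (c : K) * c = 1 := congrArg Units.val (mul_eq_one_iff_eq_inv.mpr h4)
      rw [hc, one_def, negOne, diag.injEq, diag.injEq]
      rcases mul_self_eq_one_iff.mp h5 with h6 | h6
      · exact Or.inl (Units.ext h6)
      · exact Or.inr (Units.ext h6)
    have h3 : ∀ i, y.lab i = y.lab ⟨0, hn⟩ := by
      intro i
      have h4 := congrArg (fun D : Mono (Fin n) K => D.lab ⟨0, hn⟩)
        (hy ⟨Equiv.swap ⟨0, hn⟩ i, fun _ => 1⟩)
      simp only [Wreath.mul_lab, Equiv.swap_apply_left, one_mul, mul_one] at h4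
      exact h4.symm
    rcases h2 ⟨0, hn⟩ with h4 | h4
    · left
      rw [← map_one (toSp n K)]
      congr 1
      exact Wreath.ext' (fun i => (h1 i).1) (fun i => by rw [h3, h4, Wreath.one_lab])
    · right
      congr 1
      exact Wreath.ext' (fun i => (h1 i).1) (fun i => by rw [h3, h4, negMono_lab])
  · rintro (rfl | rfl)
    · exact one_mem _
    · exact toSp_negMono_mem_center

theorem proj_eq_one_iff [Infinite K] (hn : 0 < n) (A : Sp n K) :
    proj n K A = 1 ↔ A = 1 ∨ A = toSp n K negMono := by
  rw [← mem_center_iff hn]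
  exact QuotientGroup.eq_one_iff A

theorem proj_eq_proj_iff [Infinite K] (hn : 0 < n) (A B : Sp n K) :
    proj n K A = proj n K B ↔ A = B ∨ A = toSp n K negMono * B := by
  rw [← mul_inv_eq_one, ← map_inv, ← map_mul, proj_eq_one_iff hn, mul_inv_eq_one,
    mul_inv_eq_iff_eq_mul]

theorem proj_toSp_mem_stdTorus_iff [Infinite K] (hn : 0 < n) (B : Mono (Fin n) K) :
    proj n K (toSp n K B) ∈ stdTorus n K ↔ signedPerm B = 1 := by
  constructor
  · rintro ⟨_, ⟨d, rfl⟩, h⟩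
    rw [diagHom_eq, proj_eq_proj_iff hn, ← map_mul] at h
    have hd : signedPerm (Wreath.base fun i => diag (d i) : Mono (Fin n) K) = 1 :=
      signedPerm_eq_one_iff.mpr ⟨d, rfl⟩
    rcases h with h | h <;> rw [toSp_injective.eq_iff] at h
    · rw [← h, hd]
    · have := congrArg signedPerm h
      rwa [map_mul, signedPerm_negMono, one_mul, hd, eq_comm] at this
  · intro h
    obtain ⟨d, rfl⟩ := signedPerm_eq_one_iff.mp h
    exact ⟨_, ⟨d, rfl⟩, by rw [diagHom_eq]⟩

/-- The normalizer of the standard torus consists of the images of the monomial matrices. -/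
theorem mem_normalizer_stdTorus_iff [Infinite K] (hn : 0 < n) (x : PSp n K) :
    x ∈ Subgroup.normalizer (stdTorus n K : Set (PSp n K)) ↔
      ∃ B, proj n K (toSp n K B) = x := by
  constructor
  · intro hx
    obtain ⟨A, rfl⟩ := QuotientGroup.mk'_surjective _ x
    change proj n K A ∈ _ at hx
    obtain ⟨B, hB⟩ := mem_range_toSp A fun d => by
      obtain ⟨_, ⟨d', rfl⟩, h⟩ := (Subgroup.mem_normalizer_iff.mp hx _).mp
        (⟨_, ⟨d, rfl⟩, rfl⟩ : proj n K (diagHom n K d) ∈ stdTorus n K)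
      rw [← map_mul, ← map_inv, ← map_mul, proj_eq_proj_iff hn] at h
      have hd : ∃ e, A * diagHom n K d * A⁻¹ = diagHom n K e := by
        rcases h with h | h
        · exact ⟨d', h.symm⟩
        · refine ⟨fun i => -1 * d' i, ?_⟩
          have h1 : toSp n K negMono * toSp n K negMono = 1 := by
            rw [← map_mul, negMono_mul_negMono, map_one]
          have h2 : A * diagHom n K d * A⁻¹ = toSp n K negMono * diagHom n K d' := by
            rw [h, ← mul_assoc, h1, one_mul]
          rw [h2, diagHom_eq, diagHom_eq, ← map_mul]
          rfl
      obtain ⟨e, he⟩ := hd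
      rw [mul_inv_eq_iff_eq_mul] at he
      exact ⟨_, (congrArg Subtype.val he).trans (congrArg (· * A.1) (coe_diagHom e))⟩
    exact ⟨B, by rw [hB]; rfl⟩
  · rintro ⟨B, rfl⟩
    rw [Subgroup.mem_normalizer_iff]
    have key : ∀ (B : Mono (Fin n) K) (h : PSp n K), h ∈ stdTorus n K →
        proj n K (toSp n K B) * h * (proj n K (toSp n K B))⁻¹ ∈ stdTorus n K := by
      rintro B _ ⟨_, ⟨d, rfl⟩, rfl⟩
      rw [diagHom_eq, ← map_mul, ← map_inv, ← map_mul, ← map_mul, ← map_inv, ← map_mul,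
        proj_toSp_mem_stdTorus_iff hn, map_mul, map_mul,
        signedPerm_eq_one_iff.mpr ⟨d, rfl⟩, mul_one, map_inv, mul_inv_cancel]
    refine fun h => ⟨key B h, fun hh => ?_⟩
    have := key B⁻¹ _ hh
    rw [map_inv, map_inv, inv_inv] at this
    convert this using 1
    group

end normalizer

/-! ### Reduction to monomial matrices -/

/-- A complement in the image of a homomorphism corresponds to a subgroup of its source. -/
theorem hasComplementIn_iff_splits {P ι K : Type*} [Group P] [Field K] {f : K ≃+* K}
    {w : Mono ι K} (θ : Mono ι K →* P) (T N : Subgroup P)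
    (h1 : ∀ y, θ y = 1 ↔ y = 1 ∨ y = negMono) (h2 : ∀ x ∈ N, ∃ y, θ y = x)
    (h3 : ∀ y, θ y ∈ N ↔ frobMono f y * w = w * y)
    (h4 : ∀ y, θ y ∈ T ↔ frobMono f y * w = w * y ∧ signedPerm y = 1) (hTN : T ≤ N) :
    HasComplementIn T N ↔ Splits f w := by
  constructor
  · rintro ⟨-, -, H, hH⟩
    have hmemN : ∀ y, y ∈ (H.map N.subtype).comap θ → θ y ∈ N := by
      rintro y ⟨h, -, hy⟩
      rw [← hy]
      exact h.2
    refine ⟨(H.map N.subtype).comap θ, fun y hy => (h3 y).mp (hmemN y hy), fun y hy hs => ?_,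
      ⟨1, one_mem _, ((h1 _).mpr (Or.inr rfl)).symm⟩, fun y hy => ?_⟩
    · have hyN := hmemN y hy
      have hyT : θ y ∈ T := (h4 y).mpr ⟨(h3 y).mp hyN, hs⟩
      obtain ⟨h, hh, hy'⟩ := hy
      have hT : h ∈ T.subgroupOf N := by
        rw [Subgroup.mem_subgroupOf]
        exact (show (h : P) = θ y from hy') ▸ hyT
      have hone : h = 1 := by
        have := hH.disjoint.le_bot (show h ∈ T.subgroupOf N ⊓ H from ⟨hT, hh⟩)
        exact Subgroup.mem_bot.mp this
      rw [← h1, ← hy', hone, map_one]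
    · have hyN : θ y ∈ N := (h3 y).mpr hy
      obtain ⟨⟨⟨t, ht⟩, ⟨h, hh⟩⟩, hth⟩ := hH.surjective ⟨θ y, hyN⟩
      rw [SetLike.mem_coe] at ht hh
      have hth' : (t : P) * h = θ y := congrArg Subtype.val hth
      obtain ⟨t', ht'⟩ := h2 _ t.2
      obtain ⟨h', hh'⟩ := h2 _ h.2
      rw [Subgroup.mem_subgroupOf, ← ht', h4] at ht
      refine ⟨h', ⟨h, hh, hh'.symm⟩, ?_⟩
      have h5 : θ ((t' * h')⁻¹ * y) = 1 := by
        rw [map_mul, map_inv, map_mul, ht', hh', hth', inv_mul_cancel]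
      have h6 : signedPerm ((t' * h')⁻¹ * y) = 1 := by
        rcases (h1 _).mp h5 with h | h <;> rw [h]
        · exact map_one _
        · exact signedPerm_negMono
      rw [map_mul, map_inv, map_mul, ht.2, one_mul, inv_mul_eq_one] at h6
      exact h6
  · rintro ⟨H, ha, hb, hc, hd⟩
    refine ⟨hTN, ⟨fun t ht g => ?_⟩, (H.map θ).subgroupOf N,
      Subgroup.isComplement'_of_disjoint_and_mul_eq_univ ?_ ?_⟩
    · rw [Subgroup.mem_subgroupOf] at ht ⊢
      obtain ⟨t', ht'⟩ := h2 _ t.2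
      obtain ⟨g', hg'⟩ := h2 _ g.2
      have hN : θ (g' * t' * g'⁻¹) ∈ N := by
        rw [map_mul, map_mul, map_inv, ht', hg']
        exact (g * t * g⁻¹).2
      have : ((g * t * g⁻¹ : N) : P) = θ (g' * t' * g'⁻¹) := by
        rw [map_mul, map_mul, map_inv, ht', hg']; rfl
      rw [this, h4]
      rw [← ht', h4] at ht
      refine ⟨(h3 _).mp hN, ?_⟩
      rw [map_mul, map_mul, ht.2, mul_one, map_inv, mul_inv_cancel]
    · rw [Subgroup.disjoint_def]
      intro x hx hx'
      rw [Subgroup.mem_subgroupOf] at hx hx'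
      obtain ⟨y, hy, hyx⟩ := hx'
      rw [← hyx, h4] at hx
      apply Subtype.ext
      rw [← hyx]
      exact (h1 y).mpr (hb y hy hx.2)
    · rw [Set.eq_univ_iff_forall]
      intro x
      obtain ⟨y, hy⟩ := h2 _ x.2
      have hyN : θ y ∈ N := hy ▸ x.2
      obtain ⟨h, hh, hs⟩ := hd y ((h3 y).mp hyN)
      have hhN : θ h ∈ N := (h3 h).mpr (ha h hh)
      refine Set.mem_mul.mpr ⟨x * ⟨θ h, hhN⟩⁻¹, ?_, ⟨θ h, hhN⟩, ⟨h, hh, rfl⟩, by group⟩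
      rw [SetLike.mem_coe, Subgroup.mem_subgroupOf]
      have : ((x * (⟨θ h, hhN⟩ : N)⁻¹ : N) : P) = θ (y * h⁻¹) := by
        rw [map_mul, map_inv, hy]; rfl
      rw [this, h4]
      refine ⟨(h3 _).mp ?_, by rw [map_mul, map_inv, hs, mul_inv_cancel]⟩
      rw [map_mul, map_inv]
      exact mul_mem hyN (inv_mem hhN)

/-- Conjugation by `g` turns the torus and its normalizer into groups of monomial matrices, and
the Frobenius map into its twist by a monomial matrix `w`. -/
theorem hasComplementIn_conj_iff {K : Type*} [Field K] [Infinite K] {n : ℕ} (hn : 0 < n)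
    (f : K ≃+* K) (g : Sp n K) (w : Mono (Fin n) K) (hg : spCongr n f g = toSp n K w * g)
    {S : Subgroup (PSp n K)}
    (hS : S = (stdTorus n K).map (MulAut.conj (proj n K g)⁻¹).toMonoidHom) :
    HasComplementIn
      (S ⊓ ((spCongr n f).toMonoidHom.eqLocus (MonoidHom.id (Sp n K))).map (proj n K))
      (Subgroup.normalizer S ⊓
        ((spCongr n f).toMonoidHom.eqLocus (MonoidHom.id (Sp n K))).map (proj n K)) ↔
      Splits f w := by
  let θ : Mono (Fin n) K →* PSp n K :=
    (MulAut.conj (proj n K g)⁻¹).toMonoidHom.comp ((proj n K).comp (toSp n K))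
  have hθ : ∀ y, θ y = (proj n K g)⁻¹ * proj n K (toSp n K y) * proj n K g := fun y => by
    simp [θ]
  have hθ' : ∀ y, θ y = proj n K (g⁻¹ * toSp n K y * g) := fun y => by
    rw [hθ, map_mul, map_mul, map_inv]
  have hmemS : ∀ x, x ∈ S ↔ proj n K g * x * (proj n K g)⁻¹ ∈ stdTorus n K := by
    intro x
    rw [hS]
    constructor
    · rintro ⟨t, ht, rfl⟩
      rw [SetLike.mem_coe] at ht
      convert ht using 1
      simp only [MulEquiv.toMonoidHom_eq_coe, MonoidHom.coe_coe, MulAut.conj_apply]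
      group
    · intro hx
      refine ⟨_, hx, ?_⟩
      simp only [MulEquiv.toMonoidHom_eq_coe, MonoidHom.coe_coe, MulAut.conj_apply]
      group
  have hmemN : ∀ x, x ∈ Subgroup.normalizer (S : Set (PSp n K)) ↔
      proj n K g * x * (proj n K g)⁻¹ ∈ Subgroup.normalizer (stdTorus n K : Set (PSp n K)) := by
    intro x
    rw [Subgroup.mem_normalizer_iff, Subgroup.mem_normalizer_iff]
    constructor
    · intro h t
      have := h ((proj n K g)⁻¹ * t * proj n K g)
      rw [hmemS, hmemS] at this
      convert this using 2 <;> group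
    · intro h t
      rw [hmemS, hmemS, h (proj n K g * t * (proj n K g)⁻¹)]
      convert Iff.rfl using 2
      group
  have hconj : ∀ y, proj n K g * θ y * (proj n K g)⁻¹ = proj n K (toSp n K y) := fun y => by
    rw [hθ]; group
  have hθS : ∀ y, θ y ∈ S ↔ signedPerm y = 1 := fun y => by
    rw [hmemS, hconj, proj_toSp_mem_stdTorus_iff hn]
  have hθN : ∀ y, θ y ∈ Subgroup.normalizer (S : Set (PSp n K)) := fun y => by
    rw [hmemN, hconj, mem_normalizer_stdTorus_iff hn]
    exact ⟨y, rfl⟩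
  have hfix : ∀ y, spCongr n f (g⁻¹ * toSp n K y * g) = g⁻¹ * toSp n K y * g ↔
      frobMono f y * w = w * y := by
    intro y
    rw [map_mul, map_mul, map_inv, hg, spCongr_toSp, ← toSp_injective.eq_iff, map_mul, map_mul]
    constructor
    · intro h
      have := congrArg (fun x => toSp n K w * g * x * g⁻¹) h
      calc _ = toSp n K w * g * ((toSp n K w * g)⁻¹ * toSp n K (frobMono f y) *
            (toSp n K w * g)) * g⁻¹ := by group
        _ = _ := by rw [this]; group
    · intro h
      calc _ = g⁻¹ * (toSp n K w)⁻¹ * (toSp n K (frobMono f y) * toSp n K w) * g := by group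
        _ = _ := by rw [h]; group
  have hθG : ∀ y, θ y ∈ ((spCongr n f).toMonoidHom.eqLocus (MonoidHom.id (Sp n K))).map (proj n K)
      ↔ frobMono f y * w = w * y := by
    intro y
    rw [← hfix]
    constructor
    · rintro ⟨B, hB, h⟩
      have hB' : spCongr n f B = B := hB
      have hz : spCongr n f (toSp n K negMono) = toSp n K negMono := by
        rw [spCongr_toSp, frobMono_negMono]
      rw [hθ', eq_comm, proj_eq_proj_iff hn] at h
      rcases h with h | h <;> rw [h]
      · exact hB'
      · rw [map_mul, hz, hB']
    · intro h
      exact ⟨_, h, (hθ' y).symm⟩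
  refine hasComplementIn_iff_splits θ _ _ (fun y => ?_) (fun x hx => ?_) (fun y => ?_)
    (fun y => ?_) ?_
  · rw [hθ, mul_assoc, inv_mul_eq_one, right_eq_mul, proj_eq_one_iff hn,
      ← map_one (toSp n K), toSp_injective.eq_iff, toSp_injective.eq_iff]
  · obtain ⟨y, hy⟩ := (mem_normalizer_stdTorus_iff hn _).mp ((hmemN x).mp hx.1)
    refine ⟨y, ?_⟩
    rw [hθ, hy]
    group
  · rw [Subgroup.mem_inf, hθG]
    exact and_iff_right (hθN y)
  · rw [Subgroup.mem_inf, hθG, hθS, and_comm]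
  · exact inf_le_inf_right _ Subgroup.le_normalizer

end SympTorus

namespace SympTorus
open MonoSL2

/-! ### Cycle types and the proof of the classification -/

section classification

variable {K : Type*} [Field K] {n : ℕ}

/-- The type of a torus determines the splitting problem for monomial matrices. -/
theorem splits_iff_of_hasCycleType [IsAlgClosed K] {f : K ≃+* K} {q : ℕ} (hq : 2 ≤ q)
    (hf : ∀ x, f x = x ^ q) {φ : Equiv.Perm (Fin n ⊕ Fin n)} {m k : ℕ} {l : ℕ → ℕ}
    (hl : ∀ i, 1 ≤ i → i ≤ m → 0 < l i) (hφ : HasCycleType φ m k l) (w : Mono (Fin n) K)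
    (hp : ∀ x, absIdx (φ x) = w.perm (absIdx x))
    (hs : ∀ x, (if (φ x).isLeft then (1 : ℤˣ) else -1) =
      sgn (w.lab (absIdx x)) * if x.isLeft then 1 else -1) (δ : Fin m → ℕ) :
    Splits f w ↔ Splits f (stdMono K (fun i : Fin m => l (i + 1))
      (fun i => if (i : ℕ) + 1 ≤ k then 1 else 0) δ) := by
  obtain ⟨r, hbij, hclose⟩ := hφ
  let e : (Σ i : Fin m, Fin (l (i + 1))) ≃ Fin n := Equiv.ofBijective _ hbij
  have he : ∀ j i, e ⟨j, i⟩ = absIdx ((φ ^ (i : ℕ)) (Sum.inl (r j))) := fun _ _ => rfl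
  have hclose' : ∀ j : Fin m, absIdx ((φ ^ l (j + 1)) (Sum.inl (r j))) = r j := fun j => by
    rw [hclose]
    split_ifs <;> rfl
  rw [← splits_reindex_iff e.symm]
  refine splits_iff_stdMono f hq hf _ _ _ (fun j => hl _ (by omega) (by omega)) _
    (fun j i => ?_) (fun j => ?_)
  · rw [Wreath.reindex_perm, Equiv.symm_symm, Equiv.symm_apply_eq, he, he, ← hp,
      ← Equiv.Perm.mul_apply, ← pow_succ', finRotate_val]
    split_ifs with h
    · rw [h, hclose']
      rfl
    · rfl
  · have key : ∀ c : ℕ, ∏ i ∈ Finset.range c, sgn (w.lab (absIdx ((φ ^ i) (Sum.inl (r j))))) =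
        if ((φ ^ c) (Sum.inl (r j))).isLeft then 1 else -1 := by
      intro c
      induction c with
      | zero => simp
      | succ c ih => rw [Finset.prod_range_succ, ih, pow_succ', Equiv.Perm.mul_apply, hs, mul_comm]
    have h1 := key (l (j + 1))
    rw [Finset.prod_range, hclose] at h1
    simp only [Wreath.reindex_lab, Equiv.symm_symm, he]
    rw [h1]
    split_ifs <;> simp_all

/-- A complement for a torus of given type in terms of the standard monomial matrix. -/
theorem hasComplementIn_iff_stdMono {p a : ℕ} [IsAlgClosed K] [ExpChar K p]
    [PerfectRing K p] (hq : 2 ≤ p ^ a) (hn : 0 < n) {S : Subgroup (PSp n K)} {m k : ℕ} {l : ℕ → ℕ}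
    (hl : ∀ i, 1 ≤ i → i ≤ m → 0 < l i) (htype : HasType n p a K S m k l) (δ : Fin m → ℕ) :
    HasComplementIn (S ⊓ finitePSp n p a K) (Subgroup.normalizer S ⊓ finitePSp n p a K) ↔
      Splits (iterateFrobeniusEquiv K p a) (stdMono K (fun i : Fin m => l (i + 1))
        (fun i => if (i : ℕ) + 1 ≤ k then 1 else 0) δ) := by
  obtain ⟨g, φ, hS, -, ⟨A, hA, hAφ⟩, hcyc⟩ := htype
  obtain ⟨g, rfl⟩ := QuotientGroup.mk'_surjective _ g
  have : Infinite K := IsAlgClosed.instInfinite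
  have hA' : proj n K A = proj n K (spCongr n (iterateFrobeniusEquiv K p a) g * g⁻¹) := by
    rw [hA, map_mul, map_inv]
    rfl
  rw [proj_eq_proj_iff hn] at hA'
  obtain ⟨B, hB, hp, hs⟩ := exists_toSp_eq A φ hAφ
  obtain ⟨w, hw, hwp, hws⟩ : ∃ w : Mono (Fin n) K,
      spCongr n (iterateFrobeniusEquiv K p a) g = toSp n K w * g ∧ w.perm = B.perm ∧
        ∀ i, sgn (w.lab i) = sgn (B.lab i) := by
    rcases hA' with h | h
    · exact ⟨B, by rw [hB, h, inv_mul_cancel_right], rfl, fun _ => rfl⟩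
    · refine ⟨negMono * B, ?_, by simp, fun i => by simp⟩
      rw [map_mul, hB, h, ← mul_assoc, ← map_mul, negMono_mul_negMono, map_one, one_mul,
        inv_mul_cancel_right]
  refine (hasComplementIn_conj_iff hn _ g w hw hS).trans
    (splits_iff_of_hasCycleType hq (iterateFrobeniusEquiv_def K p a) hl hcyc w
      (fun x => ?_) (fun x => ?_) δ)
  · rw [hwp, hp]
  · rw [hws, hs]

/-- The action of the Frobenius map on the elements of order four. -/
theorem map_of_sq_eq_neg_one {f : K ≃+* K} {q : ℕ} (hf : ∀ x, f x = x ^ q) {c : Kˣ}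
    (hc : c * c = -1) :
    (q % 4 = 1 → Units.map (f : K →* K) c = (-1) ^ 0 * c) ∧
      (q % 4 = 3 → Units.map (f : K →* K) c = (-1) ^ 1 * c) := by
  have h1 : Units.map (f : K →* K) c = c ^ q := Units.ext (by simp [hf])
  have h2 : c ^ 4 = 1 := by
    rw [show 4 = 2 * 2 from rfl, pow_mul, pow_two c, hc]
    simp
  have h3 : c ^ q = c ^ (q % 4) := by
    conv_lhs => rw [← Nat.div_add_mod q 4, pow_add, pow_mul, h2, one_pow, one_mul]
  rw [h1, h3]
  constructor <;> intro h <;> rw [h]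
  · simp
  · rw [pow_succ, pow_two, hc, pow_one]

/-- For two cycles and odd `q` a parity condition on both cycles is necessary and sufficient. -/
theorem splits_fin_two_iff [IsAlgClosed K] (h2 : (-1 : Kˣ) ≠ 1) {f : K ≃+* K} {κ : ℕ}
    (hκ : κ ≤ 1)
    (hf : ∀ c : Kˣ, c * c = -1 → Units.map (f : K →* K) c = (-1) ^ κ * c) {L ν : Fin 2 → ℕ}
    (hL : ∀ j, 0 < L j) (hν : ∀ j, ν j ≤ 1) :
    (∃ δ, Splits f (stdMono K L ν δ)) ↔ ∀ j, κ * L j % 2 = ν j := by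
  constructor
  · rintro ⟨δ, h⟩ j
    have h1 : (-1 : Kˣ) ^ (κ * L j) = (-1) ^ ν j :=
      parity_of_splits h2 hf hL h (j₀ := Equiv.swap 0 1 j) (by revert j; decide)
    have h3 : (-1 : Kˣ) ^ (κ * L j % 2) = (-1) ^ (κ * L j) := by
      conv_rhs => rw [← Nat.div_add_mod (κ * L j) 2, pow_add, pow_mul]
      simp
    rw [← h3] at h1
    rcases Nat.mod_two_eq_zero_or_one (κ * L j) with h4 | h4 <;>
    rcases Nat.le_one_iff_eq_zero_or_eq_one.mp (hν j) with h5 | h5 <;> rw [h4, h5] at h1 ⊢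
    · rw [pow_zero, pow_one] at h1
      exact absurd h1.symm h2
    · rw [pow_zero, pow_one] at h1
      exact absurd h1 h2
  · intro h
    obtain ⟨x, hx⟩ := IsAlgClosed.exists_pow_nat_eq (-1 : K) (show 0 < 2 by decide)
    have hx0 : x ≠ 0 := by
      rintro rfl
      simp at hx
    have hi : Units.mk0 x hx0 * Units.mk0 x hx0 = -1 := Units.ext (by simpa [pow_two] using hx)
    refine ⟨fun j => (κ * L j - ν j) / 2, splits_of_fin_two hL hν hi (hf _ hi) fun j => ?_⟩
    have := h j
    rcases Nat.le_one_iff_eq_zero_or_eq_one.mp hκ with rfl | rfl <;> omega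

end classification
end SympTorus

theorem theorem2 (p a q n : ℕ) [Fact p.Prime] (ha : 0 < a) (hq : q = p ^ a) (hn : 0 < n)
    (Tbar : Subgroup (SympTorus.PSp n (AlgebraicClosure (ZMod p))))
    (hTmax : SympTorus.IsMaximalTorus n (AlgebraicClosure (ZMod p)) Tbar)
    (hTinv : Tbar.map (SympTorus.sigma n p a (AlgebraicClosure (ZMod p))).toMonoidHom = Tbar)
    (m k : ℕ) (hk : k ≤ m) (l : ℕ → ℕ) (hl : ∀ i, 1 ≤ i → i ≤ m → 0 < l i)
    (htype : SympTorus.HasType n p a (AlgebraicClosure (ZMod p)) Tbar m k l) :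
    SympTorus.HasComplementIn
        (Tbar ⊓ SympTorus.finitePSp n p a (AlgebraicClosure (ZMod p)))
        (Subgroup.normalizer Tbar ⊓ SympTorus.finitePSp n p a (AlgebraicClosure (ZMod p))) ↔
      (p = 2 ∨
        m = 1 ∨
        (m = 2 ∧ k = 2 ∧ Odd (l 1) ∧ Odd (l 2) ∧ q ≡ 3 [MOD 4]) ∨
        (m = 2 ∧ k = 1 ∧ Odd (l 1) ∧ Even (l 2) ∧ q ≡ 3 [MOD 4]) ∨
        (m = 2 ∧ k = 0 ∧ Even (l 1) ∧ Even (l 2) ∧ q ≡ 3 [MOD 4]) ∨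
        (m = 2 ∧ k = 0 ∧ q ≡ 1 [MOD 4])) := by
  have hp := (Fact.out : p.Prime)
  have hq2 : 2 ≤ p ^ a := hp.two_le.trans (Nat.le_self_pow ha.ne' p)
  have hf := iterateFrobeniusEquiv_def (AlgebraicClosure (ZMod p)) p a
  rw [← hq] at hf
  have hm0 : m ≠ 0 := by
    rintro rfl
    obtain ⟨_, _, _, _, _, _, hbij, _⟩ := htype
    obtain ⟨⟨i, -⟩, -⟩ := hbij.surjective ⟨0, hn⟩
    exact i.elim0
  have hiff := SympTorus.hasComplementIn_iff_stdMono hq2 hn hl htype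
  have hL : ∀ i : Fin m, 0 < l (i + 1) := fun i => hl _ (by omega) (by omega)
  by_cases h2 : (-1 : (AlgebraicClosure (ZMod p))ˣ) = 1
  · have hp2 : p = 2 := by
      have h3 : (2 : AlgebraicClosure (ZMod p)) = 0 := by
        have h4 : (-1 : AlgebraicClosure (ZMod p)) = 1 := congrArg Units.val h2
        linear_combination -h4
      have h5 := (CharP.cast_eq_zero_iff (AlgebraicClosure (ZMod p)) p 2).mp (by exact_mod_cast h3)
      exact (Nat.prime_dvd_prime_iff_eq hp Nat.prime_two).mp h5
    exact iff_of_true ((hiff fun _ => 0).mpr (SympTorus.splits_of_neg_one_eq_one h2 _ _ _ _))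
      (Or.inl hp2)
  have hp2 : p ≠ 2 := by
    rintro rfl
    exact h2 (Units.ext (by
      have : (2 : AlgebraicClosure (ZMod 2)) = 0 := CharTwo.two_eq_zero
      rw [Units.val_neg, Units.val_one]
      linear_combination -this))
  have hodd : q % 2 = 1 := by
    rw [hq, ← Nat.odd_iff]
    exact (hp.odd_of_ne_two hp2).pow
  obtain rfl | rfl | hm : m = 1 ∨ m = 2 ∨ 3 ≤ m := by omega
  · exact iff_of_true ((hiff fun _ => 0).mpr (SympTorus.splits_of_subsingleton _ hL))
      (Or.inr (Or.inl rfl))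
  · have key : ∀ κ ≤ 1, (∀ c : (AlgebraicClosure (ZMod p))ˣ, c * c = -1 → Units.map
        (iterateFrobeniusEquiv (AlgebraicClosure (ZMod p)) p a : _ →* _) c = (-1) ^ κ * c) →
        (SympTorus.HasComplementIn
        (Tbar ⊓ SympTorus.finitePSp n p a (AlgebraicClosure (ZMod p)))
        (Subgroup.normalizer Tbar ⊓ SympTorus.finitePSp n p a (AlgebraicClosure (ZMod p))) ↔
        (κ * l 1 % 2 = if 1 ≤ k then 1 else 0) ∧ (κ * l 2 % 2 = if 2 ≤ k then 1 else 0)) := by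
      intro κ hκ hfκ
      have h3 := SympTorus.splits_fin_two_iff h2 hκ hfκ (L := fun i => l (i + 1))
        (ν := fun i => if (i : ℕ) + 1 ≤ k then 1 else 0) hL (fun j => by split_ifs <;> omega)
      rw [Fin.forall_fin_two] at h3
      exact ⟨fun h => h3.mp ⟨_, (hiff fun _ => 0).mp h⟩,
        fun h => (h3.mpr h).elim fun δ hδ => (hiff δ).mpr hδ⟩
    simp only [Nat.odd_iff, Nat.even_iff, Nat.ModEq]
    obtain hq4 | hq4 : q % 4 = 1 ∨ q % 4 = 3 := by omega
    · rw [key 0 (by omega) (fun c hc => (SympTorus.map_of_sq_eq_neg_one hf hc).1 hq4)]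
      obtain rfl | rfl | rfl : k = 0 ∨ k = 1 ∨ k = 2 := by omega
      all_goals simp [hp2, hq4]
    · rw [key 1 (by omega) (fun c hc => (SympTorus.map_of_sq_eq_neg_one hf hc).2 hq4)]
      obtain rfl | rfl | rfl : k = 0 ∨ k = 1 ∨ k = 2 := by omega
      all_goals simp [hp2, hq4]
  · refine iff_of_false (fun h => ?_) (by omega)
    exact SympTorus.not_splits_of_three h2 hL (j₁ := ⟨0, by omega⟩) (j₂ := ⟨1, by omega⟩)
      (j₃ := ⟨2, by omega⟩) (by simp) (by simp) (by simp) ((hiff fun _ => 0).mp h)
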